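/- Let $\mathcal{SC}$ be the von Neumann algebra generated by the semicircular operators $S(h)=l(h)+l(h)^*$, $h\in L^2_{\mathbb R}(\mathbb R_+)$, on the full Fock space $\bigoplus_{n\ge 0}L^2(\mathbb R_+)^{\otimes n}=\bigoplus_{n\ge0}L^2(\mathbb R_+^n)$ of $L^2(\mathbb R_+)=L^2_{\mathbb C}(\mathbb R_+)$, with the vacuum state $\tau$; its space $L^2(\mathcal{SC},\tau)$ is identified with the Fock space through $X\mapsto X\Omega$. Let $\mathcal{SC}_{alg}$ be the unital $*$-algebra generated by the $S(h)$, and let $I_n:L^2(\mathbb R_+^n)\to L^2(\mathcal{SC},\tau)$ be the multiple Wigner integral, i.e. the linear isometry with $I_n(1_A)=(S_{v_1}-S_{u_1})\cdots(S_{v_n}-S_{u_n})$ for every rectangle $A=\prod_i[u_i,v_i]$ that does not meet the diagonals, where $S_t=S(1_{[0,t]})$. For $m_1,\dots,m_k\ge0$ let $I_{m_1}\otimes\cdots\otimes I_{m_k}:L^2(\mathbb R_+^{m_1}\times\cdots\times\mathbb R_+^{m_k})\to L^2(\mathcal{SC}^{\otimes k},\tau^{\otimes k})$ be the continuous linear extension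 of $f_1\otimes\cdots\otimes f_k\mapsto I_{m_1}(f_1)\otimes\cdots\otimes I_{m_k}(f_k)$. Let $\mathcal P_n$ be the closed subspace of $L^2(\mathcal{SC},\tau)$ generated by the products $S(h_1)\cdots S(h_k)$, $0\le k\le n$, $h_1,\dots,h_k\in L^2_{\mathbb R}(\mathbb R_+)$. The free Malliavin derivative $\nabla$ on $\mathcal{SC}_{alg}$ is the unique linear map into $L^2(\mathbb R_+)\odot\mathcal{SC}_{alg}\odot\mathcal{SC}_{alg}$ (algebraic tensor products) such that $\nabla S(h)=h\cdot 1\otimes 1$ and $\nabla(AB)=A\cdot\nabla B+\nabla A\cdot B$, where $A$ multiplies the first leg from the left and $B$ multiplies the second leg from the right. Put $$\nabla^p_{t_1,\dots,t_p}=(\mathrm{id}^{\otimes(p-1)}\otimes\nabla_{t_p})\circ\cdots\circ(\mathrm{id}\otimes\nabla_{t_2})\circ\nabla_{t_1}.$$ Denote also by $\nabla^p$ the closure of this operator, viewed as an unbounded operator from $L^2(\mathcal{SC},\tau)$ to $L^2(\mathbb R_+^p;L^2(\mathcal{SC}^{\otimes(p+1)},\tau^{\otimes (p+1)}))$ with domain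 $\mathcal{SC}_{alg}$; let $\mathbb D^{p,2}$ be the domain of the closure. (1) Let $1\le p\le n$ and $f\in L^2(\mathbb R_+^n)$. Then $I_n(f)\in\mathbb D^{p,2}$. Moreover, for almost every $(t_1,\dots,t_p)\in\mathbb R_+^p$ and for all $1\le i_1<\cdots<i_p\le n$, let $f^{i_1,\dots,i_p}_{t_1,\dots,t_p}$ be the function of the remaining $n-p$ variables obtained from $f$ by putting $t_q$ in slot $i_q$ for $q=1,\dots,p$. This function is square integrable; the remaining variables form, in order, consecutive blocks of lengths $i_1-1,\,i_2-i_1-1,\dots,n-i_p$, so that it is regarded as an element of $L^2(\mathbb R_+^{i_1-1}\times\mathbb R_+^{i_2-i_1-1}\times\cdots\times\mathbb R_+^{n-i_p})$; and for almost every $(t_1,\dots,t_p)$ $$\nabla^p_{t_1,\dots,t_p}I_n(f)=\sum_{1\le i_1<\cdots<i_p\le n}\bigl(I_{i_1-1}\otimes I_{i_2-i_1-1}\otimes\cdots\otimes I_{n-i_p}\bigr)\bigl(f^{i_1,\dots,i_p}_{t_1,\dots,t_p}\bigr).$$ (2) If $p>n\ge0$, then $\mathcal P_n\subset\mathbb D^{p,2}$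 and $\nabla^pF=0$ for every $F\in\mathcal P_n$. -/

import Mathlib

open MeasureTheory Set NNReal ENNReal TensorProduct

noncomputable section

namespace WignerSpace

/-- Lebesgue measure on the half line `ℝ₊ = [0, ∞)`. -/
instance halfLineMeasureSpace : MeasureSpace ℝ≥0 :=
  ⟨Measure.comap ((↑) : ℝ≥0 → ℝ) volume⟩

theorem measurableEmbedding_coe : MeasurableEmbedding ((↑) : ℝ≥0 → ℝ) :=
  MeasurableEmbedding.subtype_coe measurableSet_Ici

theorem volume_halfLine (s : Set ℝ≥0) :
    (volume : Measure ℝ≥0) s = volume (((↑) : ℝ≥0 → ℝ) '' s) :=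
  measurableEmbedding_coe.comap_apply _ _

instance sigmaFinite_halfLine : SigmaFinite (volume : Measure ℝ≥0) := by
  refine ⟨⟨⟨fun n => ((↑) : ℝ≥0 → ℝ) ⁻¹' spanningSets volume n, fun _ => trivial, fun n => ?_, ?_⟩⟩⟩
  · rw [volume_halfLine]
    exact (measure_mono (image_preimage_subset _ _)).trans_lt (measure_spanningSets_lt_top _ n)
  · rw [← preimage_iUnion, iUnion_spanningSets, preimage_univ]

section Tools

set_option linter.unusedSectionVars false

variable {X Y : Type*} [MeasurableSpace X] [MeasurableSpace Y] {ν : Measure X} {μ : Measure Y}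
  {E : Type*} [NormedAddCommGroup E] [NormedSpace ℂ E]

theorem extend_zero_eq_indicator (ι : X → Y) (g : X → E) :
    (range ι).indicator (Function.extend ι g 0) = Function.extend ι g 0 := by
  refine indicator_eq_self.2 fun y hy => ?_
  by_contra h
  exact hy (Function.extend_apply' _ _ _ fun ⟨x, hx⟩ => h ⟨x, hx⟩)

theorem memLp_extend {ι : X → Y} (hι : MeasurableEmbedding ι)
    (hμ : ν.map ι = μ.restrict (range ι)) {g : X → E} (hg : MemLp g 2 ν) :
    MemLp (Function.extend ι g 0) 2 μ := by
  rw [← extend_zero_eq_indicator, memLp_indicator_iff_restrict hι.measurableSet_range, ← hμ,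
    hι.memLp_map_measure_iff, Function.extend_comp hι.injective]
  exact hg

theorem eLpNorm_extend {ι : X → Y} (hι : MeasurableEmbedding ι)
    (hμ : ν.map ι = μ.restrict (range ι)) (g : X → E) :
    eLpNorm (Function.extend ι g 0) 2 μ = eLpNorm g 2 ν := by
  rw [← extend_zero_eq_indicator, eLpNorm_indicator_eq_eLpNorm_restrict hι.measurableSet_range,
    ← hμ, hι.eLpNorm_map_measure, Function.extend_comp hι.injective]

theorem ae_of_ae_comp {ι : X → Y} (hι : MeasurableEmbedding ι)
    (hμ : ν.map ι = μ.restrict (range ι)) {P : Y → Prop}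
    (h1 : ∀ᵐ x ∂ν, P (ι x)) (h2 : ∀ y, y ∉ range ι → P y) : ∀ᵐ y ∂μ, P y := by
  have h3 := hι.ae_map_iff.2 h1
  rw [hμ, ae_restrict_iff' hι.measurableSet_range] at h3
  filter_upwards [h3] with y hy
  by_cases hm : y ∈ range ι
  exacts [hy hm, h2 y hm]

theorem extend_ae_congr {ι : X → Y} (hι : MeasurableEmbedding ι)
    (hμ : ν.map ι = μ.restrict (range ι)) {g g' : X → E} (h : g =ᵐ[ν] g') :
    Function.extend ι g 0 =ᵐ[μ] Function.extend ι g' 0 := by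
  refine ae_of_ae_comp hι hμ ?_ fun y hy => ?_
  · filter_upwards [h] with x hx
    rw [hι.injective.extend_apply, hι.injective.extend_apply, hx]
  · rw [Function.extend_apply' _ _ _ fun ⟨x, hx⟩ => hy ⟨x, hx⟩,
      Function.extend_apply' _ _ _ fun ⟨x, hx⟩ => hy ⟨x, hx⟩]

/-- Extension by zero along a measurable embedding `ι : X → Y` which carries `ν` to the
restriction of `μ` to the range of `ι`, as a linear isometry `L²(X, ν) → L²(Y, μ)`. -/
def extendZero (ι : X → Y) (hι : MeasurableEmbedding ι) (hμ : ν.map ι = μ.restrict (range ι)) :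
    Lp E 2 ν →ₗᵢ[ℂ] Lp E 2 μ where
  toFun g := (memLp_extend hι hμ (Lp.memLp g)).toLp (Function.extend ι g 0)
  map_add' g g' := by
    rw [← MemLp.toLp_add]
    refine MemLp.toLp_congr _ _ ((extend_ae_congr hι hμ (Lp.coeFn_add g g')).trans (.of_eq ?_))
    funext y
    by_cases hy : ∃ x, ι x = y
    · obtain ⟨x, rfl⟩ := hy
      simp [hι.injective.extend_apply]
    · simp [Function.extend_apply' _ _ _ hy]
  map_smul' c g := by
    rw [RingHom.id_apply, ← MemLp.toLp_const_smul]
    refine MemLp.toLp_congr _ _ ((extend_ae_congr hι hμ (Lp.coeFn_smul c g)).trans (.of_eq ?_))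
    funext y
    by_cases hy : ∃ x, ι x = y
    · obtain ⟨x, rfl⟩ := hy
      simp [hι.injective.extend_apply]
    · simp [Function.extend_apply' _ _ _ hy]
  norm_map' g := by
    change ‖(memLp_extend hι hμ (Lp.memLp g)).toLp (Function.extend ι g 0)‖ = ‖g‖
    rw [Lp.norm_toLp, eLpNorm_extend hι hμ, Lp.norm_def]

theorem coeFn_extendZero (ι : X → Y) (hι : MeasurableEmbedding ι)
    (hμ : ν.map ι = μ.restrict (range ι)) (g : Lp E 2 ν) :
    extendZero ι hι hμ g =ᵐ[μ] Function.extend ι g 0 :=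
  MemLp.coeFn_toLp (memLp_extend hι hμ (Lp.memLp g))

theorem eLpNorm_tensor [SFinite μ] [SFinite ν] {h : X → ℂ} {φ : Y → E}
    (hh : AEStronglyMeasurable h ν) (hφ : AEStronglyMeasurable φ μ) :
    eLpNorm (fun z : X × Y => h z.1 • φ z.2) 2 (ν.prod μ) = eLpNorm h 2 ν * eLpNorm φ 2 μ := by
  simp only [eLpNorm_eq_lintegral_rpow_enorm_toReal two_ne_zero ofNat_ne_top, enorm_smul]
  rw [← ENNReal.mul_rpow_of_nonneg _ _ (by positivity), ← lintegral_prod_mul]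
  · congr 1
    exact lintegral_congr fun z => ENNReal.mul_rpow_of_nonneg _ _ (by positivity)
  · exact hh.enorm.pow_const _
  · exact hφ.enorm.pow_const _

theorem memLp_tensor [SFinite μ] [SFinite ν] {h : X → ℂ} {φ : Y → E}
    (hh : MemLp h 2 ν) (hφ : MemLp φ 2 μ) :
    MemLp (fun z : X × Y => h z.1 • φ z.2) 2 (ν.prod μ) :=
  ⟨hh.1.comp_fst.smul hφ.1.comp_snd, by
    rw [eLpNorm_tensor hh.1 hφ.1]; exact ENNReal.mul_lt_top hh.2 hφ.2⟩

/-- The tensor product `h ⊗ φ : (x, y) ↦ h(x) φ(y)` of `h ∈ L²(X)` and `φ ∈ L²(Y; E)`, an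
element of `L²(X × Y; E)`. -/
def tensorLp (ν : Measure X) (μ : Measure Y) [SFinite μ] [SFinite ν] :
    Lp ℂ 2 ν →L[ℂ] Lp E 2 μ →L[ℂ] Lp E 2 (ν.prod μ) :=
  LinearMap.mkContinuous₂
    (LinearMap.mk₂ ℂ
      (fun (h : Lp ℂ 2 ν) (φ : Lp E 2 μ) =>
        (memLp_tensor (Lp.memLp h) (Lp.memLp φ)).toLp (fun z : X × Y => h z.1 • φ z.2))
      (fun h h' φ => by
        rw [← MemLp.toLp_add]
        refine MemLp.toLp_congr _ _ ?_
        filter_upwards [Measure.quasiMeasurePreserving_fst.ae (Lp.coeFn_add h h')] with z hz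
        simp only [hz, Pi.add_apply, add_smul])
      (fun c h φ => by
        rw [← MemLp.toLp_const_smul]
        refine MemLp.toLp_congr _ _ ?_
        filter_upwards [Measure.quasiMeasurePreserving_fst.ae (Lp.coeFn_smul c h)] with z hz
        simp only [hz, Pi.smul_apply, smul_eq_mul, mul_smul])
      (fun h φ φ' => by
        rw [← MemLp.toLp_add]
        refine MemLp.toLp_congr _ _ ?_
        filter_upwards [Measure.quasiMeasurePreserving_snd.ae (Lp.coeFn_add φ φ')] with z hz
        simp only [hz, Pi.add_apply, smul_add])
      (fun c h φ => by
        rw [← MemLp.toLp_const_smul]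
        refine MemLp.toLp_congr _ _ ?_
        filter_upwards [Measure.quasiMeasurePreserving_snd.ae (Lp.coeFn_smul c φ)] with z hz
        simp only [hz, Pi.smul_apply]
        exact smul_comm _ _ _))
    1 (fun h φ => by
      rw [LinearMap.mk₂_apply, Lp.norm_toLp,
        eLpNorm_tensor (Lp.aestronglyMeasurable h) (Lp.aestronglyMeasurable φ),
        ENNReal.toReal_mul, Lp.norm_def, Lp.norm_def, one_mul])

theorem coeFn_tensorLp [SFinite μ] [SFinite ν] (h : Lp ℂ 2 ν) (φ : Lp E 2 μ) :
    tensorLp ν μ h φ =ᵐ[ν.prod μ] fun z => h z.1 • φ z.2 :=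
  MemLp.coeFn_toLp (memLp_tensor (Lp.memLp h) (Lp.memLp φ))

theorem inner_tensorLp [SFinite μ] [SFinite ν] (h h' : Lp ℂ 2 ν) (φ φ' : Lp ℂ 2 μ) :
    inner ℂ (tensorLp ν μ h φ) (tensorLp ν μ h' φ') = inner ℂ h h' * inner ℂ φ φ' := by
  rw [L2.inner_def, L2.inner_def, L2.inner_def, ← integral_prod_mul]
  refine integral_congr_ae ?_
  filter_upwards [coeFn_tensorLp h φ, coeFn_tensorLp h' φ'] with z hz hz'
  simp only [hz, hz', RCLike.inner_apply, smul_eq_mul, map_mul]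
  ring

end Tools


/-- Finite sequences of elements of `ℝ₊`, that is, the disjoint union `⨆ₙ ℝ₊ⁿ`. -/
abbrev Conf : Type := Σ n : ℕ, (Fin n → ℝ≥0)

/-- The inclusion of `ℝ₊ⁿ` as the `n`-th component of `⨆ₙ ℝ₊ⁿ`. -/
def toConf (n : ℕ) (s : Fin n → ℝ≥0) : Conf := ⟨n, s⟩

theorem toConf_injective (n : ℕ) : Function.Injective (toConf n) :=
  fun _ _ h => sigma_mk_injective (β := fun n : ℕ => Fin n → ℝ≥0) h

/-- The measure on `⨆ₙ ℝ₊ⁿ` which is Lebesgue measure on each `ℝ₊ⁿ` (and the unit mass on the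
one-point space `ℝ₊⁰`). -/
def confMeasure : Measure Conf :=
  Measure.sum fun n => (volume : Measure (Fin n → ℝ≥0)).map (toConf n)

theorem measurable_of_conf {Z : Type*} [MeasurableSpace Z] {f : Conf → Z}
    (hf : ∀ n, Measurable fun s : Fin n → ℝ≥0 => f ⟨n, s⟩) : Measurable f := by
  intro s hs
  rw [Sigma.instMeasurableSpace, MeasurableSpace.measurableSet_iInf]
  exact fun n => hf n hs

theorem measurableSet_conf {s : Set Conf} (hs : ∀ n, MeasurableSet (toConf n ⁻¹' s)) :
    MeasurableSet s := by
  rw [Sigma.instMeasurableSpace, MeasurableSpace.measurableSet_iInf]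
  exact hs

theorem measurableEmbedding_mk (n : ℕ) :
    MeasurableEmbedding (toConf n) where
  injective := (toConf_injective _)
  measurable := by
    intro s hs
    rw [Sigma.instMeasurableSpace, MeasurableSpace.measurableSet_iInf] at hs
    exact hs n
  measurableSet_image' := by
    intro s hs
    refine measurableSet_conf fun k => ?_
    by_cases h : k = n
    · subst h
      rwa [preimage_image_eq _ (toConf_injective _)]
    · convert MeasurableSet.empty
      ext x
      simp only [mem_preimage, mem_image, mem_empty_iff_false, iff_false, not_exists, not_and]
      intro y _ hy
      exact h (congrArg Sigma.fst hy).symm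

theorem map_mk (n : ℕ) :
    (volume : Measure (Fin n → ℝ≥0)).map (toConf n) =
      confMeasure.restrict (range (toConf n)) := by
  have hr := (measurableEmbedding_mk n).measurableSet_range
  ext s hs
  rw [Measure.restrict_apply hs, confMeasure, Measure.sum_apply _ (hs.inter hr),
    tsum_eq_single n, (measurableEmbedding_mk n).map_apply, (measurableEmbedding_mk n).map_apply]
  · congr 1
    ext x
    simp
  · intro k hk
    rw [(measurableEmbedding_mk k).map_apply]
    refine (congrArg _ ?_).trans measure_empty
    ext x
    simp only [mem_preimage, mem_inter_iff, mem_range, mem_empty_iff_false, iff_false, not_and,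
      not_exists]
    intro _ y hy
    exact hk (congrArg Sigma.fst hy).symm

theorem confMeasure_image (n : ℕ) (s : Set (Fin n → ℝ≥0)) :
    confMeasure (toConf n '' s) = volume s := by
  rw [← Measure.restrict_eq_self _ (image_subset_range (toConf n) s), ← map_mk,
    (measurableEmbedding_mk n).map_apply, preimage_image_eq _ (toConf_injective _)]

instance sigmaFinite_confMeasure : SigmaFinite confMeasure := by
  refine Measure.sigmaFinite_of_countable (S := range fun p : ℕ × ℕ =>
    (toConf p.1 '' spanningSets (volume : Measure (Fin p.1 → ℝ≥0)) p.2 : Set Conf))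
    (countable_range _) ?_ ?_
  · rintro _ ⟨p, rfl⟩
    simp only [confMeasure_image]
    exact measure_spanningSets_lt_top _ _
  · rw [eq_univ_iff_forall]
    rintro ⟨n, x⟩
    have hx : x ∈ ⋃ i, spanningSets (volume : Measure (Fin n → ℝ≥0)) i := by
      rw [iUnion_spanningSets]; trivial
    obtain ⟨i, hi⟩ := mem_iUnion.1 hx
    exact ⟨_, ⟨(n, i), rfl⟩, x, hi, rfl⟩

/-- `(t, (s₁, …, sₙ)) ↦ (t, s₁, …, sₙ)`. -/
def consConf (z : ℝ≥0 × Conf) : Conf := ⟨z.2.1 + 1, Fin.cons z.1 z.2.2⟩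

/-- `Y × Yⁿ ≃ Yⁿ⁺¹`, `(y, (y₁, …, yₙ)) ↦ (y, y₁, …, yₙ)`. -/
def consEquiv (Y : Type*) [MeasurableSpace Y] (n : ℕ) : Y × (Fin n → Y) ≃ᵐ (Fin (n + 1) → Y) :=
  (MeasurableEquiv.piFinSuccAbove (fun _ : Fin (n + 1) => Y) 0).symm

@[simp] theorem consEquiv_apply {Y : Type*} [MeasurableSpace Y] {n : ℕ} (z : Y × (Fin n → Y)) :
    consEquiv Y n z = (Fin.cons z.1 z.2 : Fin (n + 1) → Y) := by
  simp [consEquiv, MeasurableEquiv.piFinSuccAbove, Fin.insertNthEquiv]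

theorem measurePreserving_consEquiv {Y : Type*} [MeasurableSpace Y] (μ : Measure Y) [SigmaFinite μ]
    (n : ℕ) : MeasurePreserving (consEquiv Y n) (μ.prod (Measure.pi fun _ => μ))
      (Measure.pi fun _ => μ) :=
  (measurePreserving_piFinSuccAbove (fun _ : Fin (n + 1) => μ) 0).symm

theorem consEquiv_map {Y : Type*} [MeasurableSpace Y] (μ : Measure Y) [SigmaFinite μ] (n : ℕ) :
    (μ.prod (Measure.pi fun _ => μ)).map (consEquiv Y n) =
      (Measure.pi fun _ : Fin (n + 1) => μ).restrict (range (consEquiv Y n)) := by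
  rw [(measurePreserving_consEquiv μ n).map_eq, (consEquiv Y n).surjective.range_eq,
    Measure.restrict_univ]

theorem consConf_comp (n : ℕ) :
    consConf ∘ Prod.map id (toConf n) = toConf (n + 1) ∘ consEquiv ℝ≥0 n := by
  funext z
  simp [consConf, toConf]

theorem measurableEmbedding_idMk (n : ℕ) : MeasurableEmbedding
    (Prod.map id (toConf n) : ℝ≥0 × (Fin n → ℝ≥0) → ℝ≥0 × Conf) :=
  MeasurableEmbedding.id.prodMap (measurableEmbedding_mk n)

theorem measurableEmbedding_consConf : MeasurableEmbedding consConf where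
  injective := by
    rintro ⟨t, n, s⟩ ⟨t', n', s'⟩ h
    have h1 : n = n' := by simpa [consConf] using congrArg Sigma.fst h
    subst h1
    have h2 := (toConf_injective _) h
    obtain ⟨h3, h4⟩ := Fin.cons_injective2 h2
    simp_all
  measurable := by
    intro s hs
    have : consConf ⁻¹' s = ⋃ n, Prod.map id (toConf n) ''
        ((toConf (n + 1) ∘ consEquiv ℝ≥0 n) ⁻¹' s) := by
      ext ⟨t, n, x⟩
      simp only [← consConf_comp, mem_preimage, mem_iUnion, mem_image]
      constructor
      · exact fun h => ⟨n, (t, x), h, rfl⟩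
      · rintro ⟨k, z, hz, h⟩
        rw [← h]; exact hz
    rw [this]
    refine MeasurableSet.iUnion fun n => (measurableEmbedding_idMk n).measurableSet_image.2 ?_
    exact ((measurableEmbedding_mk _).measurable.comp (consEquiv ℝ≥0 n).measurable) hs
  measurableSet_image' := by
    intro s hs
    have : consConf '' s = ⋃ n, (toConf (n + 1) ∘ consEquiv ℝ≥0 n) ''
        (Prod.map id (toConf n) ⁻¹' s) := by
      ext y
      simp only [← consConf_comp, mem_iUnion, mem_image]
      constructor
      · rintro ⟨⟨t, n, x⟩, h, rfl⟩
        exact ⟨n, (t, x), h, rfl⟩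
      · rintro ⟨n, z, hz, rfl⟩
        exact ⟨_, hz, rfl⟩
    rw [this]
    exact MeasurableSet.iUnion fun n => (((measurableEmbedding_mk _).comp
      (consEquiv ℝ≥0 n).measurableEmbedding).measurableSet_image.2
        ((measurableEmbedding_idMk n).measurable hs))

theorem consConf_map :
    ((volume : Measure ℝ≥0).prod confMeasure).map consConf =
      confMeasure.restrict (range consConf) := by
  have hc := measurableEmbedding_consConf
  have h1 (n : ℕ) : ((volume : Measure ℝ≥0).prod
      ((volume : Measure (Fin n → ℝ≥0)).map (toConf n))).map consConf =
      (volume : Measure (Fin (n + 1) → ℝ≥0)).map (toConf (n + 1)) := by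
    have h2 : (volume : Measure ℝ≥0).prod ((volume : Measure (Fin n → ℝ≥0)).map (toConf n)) =
        ((volume : Measure ℝ≥0).prod (volume : Measure (Fin n → ℝ≥0))).map
          (Prod.map id (toConf n)) := by
      have := (measurableEmbedding_mk n).sigmaFinite_map (μ := volume)
      rw [← Measure.map_prod_map _ _ measurable_id (measurableEmbedding_mk n).measurable,
        Measure.map_id]
    rw [h2, Measure.map_map hc.measurable (measurableEmbedding_idMk n).measurable, consConf_comp,
      ← Measure.map_map (measurableEmbedding_mk _).measurable (consEquiv ℝ≥0 n).measurable]
    congr 1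
    exact (measurePreserving_consEquiv volume n).map_eq
  have (n : ℕ) : SFinite ((volume : Measure (Fin n → ℝ≥0)).map (toConf n)) := inferInstance
  ext s hs
  rw [Measure.restrict_apply hs, confMeasure, Measure.prod_sum_right,
    Measure.map_sum hc.measurable.aemeasurable, Measure.sum_apply _ hs,
    Measure.sum_apply _ (hs.inter hc.measurableSet_range),
    tsum_eq_zero_add' (f := fun n =>
      ((volume : Measure (Fin n → ℝ≥0)).map (toConf n)) (s ∩ range consConf)) ENNReal.summable]
  simp only [h1]
  rw [(measurableEmbedding_mk 0).map_apply]
  have h0 : toConf 0 ⁻¹' (s ∩ range consConf) = ∅ := by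
    ext x
    simp only [mem_preimage, mem_inter_iff, mem_range, mem_empty_iff_false, iff_false, not_and,
      not_exists]
    intro _ y hy
    exact absurd (congrArg Sigma.fst hy) (Nat.succ_ne_zero _)
  rw [h0, measure_empty, zero_add]
  refine tsum_congr fun n => ?_
  rw [(measurableEmbedding_mk _).map_apply, (measurableEmbedding_mk _).map_apply]
  congr 1
  ext x
  simp only [mem_preimage, mem_inter_iff, mem_range, iff_self_and]
  exact fun _ => ⟨(x 0, ⟨n, Fin.tail x⟩), by simp [consConf, toConf]⟩

/-- The full Fock space `⨁ₙ L²(ℝ₊)^{⊗ n} = ⨁ₙ L²(ℝ₊ⁿ)`, written as the space of square integrable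
complex functions on the disjoint union of the `ℝ₊ⁿ`. -/
abbrev Fock : Type := Lp ℂ 2 confMeasure

/-- The vacuum vector: the function which is `1` on the one-point space `ℝ₊⁰`, `0` elsewhere. -/
def vacuum : Fock :=
  indicatorConstLp 2 (s := range (toConf 0))
    (measurableEmbedding_mk 0).measurableSet_range
    (by rw [← image_univ, confMeasure_image]; simp [volume_pi]) 1

/-- Left creation operators: `(l(h) φ)(t, s₁, …, sₙ) = h(t) φ(s₁, …, sₙ)`. -/
def creation : Lp ℂ 2 (volume : Measure ℝ≥0) →L[ℂ] Fock →L[ℂ] Fock :=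
  (ContinuousLinearMap.compL ℂ Fock (Lp ℂ 2 ((volume : Measure ℝ≥0).prod confMeasure)) Fock
    (extendZero consConf measurableEmbedding_consConf consConf_map).toContinuousLinearMap).comp
    (tensorLp volume confMeasure)

theorem creation_apply (h : Lp ℂ 2 (volume : Measure ℝ≥0)) (φ : Fock) :
    creation h φ = extendZero consConf measurableEmbedding_consConf consConf_map
      (tensorLp volume confMeasure h φ) := rfl

/-- The inclusion `L²(ℝ₊; ℝ) → L²(ℝ₊; ℂ)`. -/
def complexify (h : Lp ℝ 2 (volume : Measure ℝ≥0)) : Lp ℂ 2 (volume : Measure ℝ≥0) :=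
  Complex.ofRealCLM.compLp h

/-- The semicircular operators `S(h) = l(h) + l(h)*`, `h ∈ L²(ℝ₊; ℝ)`. -/
def semicircular (h : Lp ℝ 2 (volume : Measure ℝ≥0)) : Fock →L[ℂ] Fock :=
  creation (complexify h) + ContinuousLinearMap.adjoint (creation (complexify h))

theorem semicircular_isSelfAdjoint (h : Lp ℝ 2 (volume : Measure ℝ≥0)) :
    IsSelfAdjoint (semicircular h) := by
  rw [semicircular, ← ContinuousLinearMap.star_eq_adjoint]
  exact IsSelfAdjoint.add_star_self _

/-- The unital `*`-algebra `𝒮𝒞_alg` generated by the semicircular operators `S(h)`,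
`h ∈ L²(ℝ₊; ℝ)`. -/
abbrev SCalg : StarSubalgebra ℂ (Fock →L[ℂ] Fock) := StarAlgebra.adjoin ℂ (range semicircular)

/-- `S(h)` as an element of `𝒮𝒞_alg`. -/
def field (h : Lp ℝ 2 (volume : Measure ℝ≥0)) : SCalg :=
  ⟨semicircular h, StarAlgebra.subset_adjoin ℂ _ (mem_range_self h)⟩

/-- The map `X ↦ X Ω`, which identifies `L²(𝒮𝒞, τ)` with the Fock space: one has
`⟨X Ω, Y Ω⟩ = τ(X* Y)` for the vacuum state `τ = ⟨Ω, · Ω⟩`, and the range is dense: see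
`toVector_denseRange`. -/
def toVector : SCalg →ₗ[ℂ] Fock where
  toFun X := (X : Fock →L[ℂ] Fock) vacuum
  map_add' _ _ := rfl
  map_smul' _ _ := rfl

/-- The complex Hilbert space `L²(ℝ₊)`. -/
abbrev HilbertC : Type := Lp ℂ 2 (volume : Measure ℝ≥0)

/-- The characterization of the free Malliavin derivative on `𝒮𝒞_alg`, as a derivation with values
in `L²(ℝ₊) ⊙ 𝒮𝒞_alg ⊙ 𝒮𝒞_alg` (algebraic tensor products): `∇ S(h) = h · 1 ⊗ 1` and
`∇ (A B) = A · ∇ B + ∇ A · B`, where `A` multiplies the first `𝒮𝒞_alg`-leg from the left and `B`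
multiplies the second one from the right. -/
structure IsMalliavinDerivation (D : SCalg →ₗ[ℂ] HilbertC ⊗[ℂ] (SCalg ⊗[ℂ] SCalg)) : Prop where
  map_field : ∀ h, D (field h) = complexify h ⊗ₜ[ℂ] ((1 : SCalg) ⊗ₜ[ℂ] (1 : SCalg))
  leibniz : ∀ A B, D (A * B) =
    LinearMap.lTensor HilbertC (LinearMap.rTensor SCalg (LinearMap.mulLeft ℂ A)) (D B) +
    LinearMap.lTensor HilbertC (LinearMap.lTensor SCalg (LinearMap.mulRight ℂ B)) (D A)

theorem derivation_unique {A H : Type*} [Ring A] [Algebra ℂ A] [AddCommGroup H] [Module ℂ H]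
    {s : Set A} (hs : Algebra.adjoin ℂ s = ⊤) {D D' : A →ₗ[ℂ] H ⊗[ℂ] (A ⊗[ℂ] A)}
    (h : ∀ a ∈ s, D a = D' a)
    (hD : ∀ a b, D (a * b) = LinearMap.lTensor H (LinearMap.rTensor A (LinearMap.mulLeft ℂ a)) (D b)
      + LinearMap.lTensor H (LinearMap.lTensor A (LinearMap.mulRight ℂ b)) (D a))
    (hD' : ∀ a b, D' (a * b) =
      LinearMap.lTensor H (LinearMap.rTensor A (LinearMap.mulLeft ℂ a)) (D' b)
      + LinearMap.lTensor H (LinearMap.lTensor A (LinearMap.mulRight ℂ b)) (D' a)) : D = D' := by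
  have h1 : D 1 = 0 := by simpa [LinearMap.mulLeft_one, LinearMap.mulRight_one] using hD 1 1
  have h1' : D' 1 = 0 := by simpa [LinearMap.mulLeft_one, LinearMap.mulRight_one] using hD' 1 1
  ext a
  have ha : a ∈ Algebra.adjoin ℂ s := by rw [hs]; trivial
  induction ha using Algebra.adjoin_induction with
  | mem a ha => exact h a ha
  | algebraMap r => rw [Algebra.algebraMap_eq_smul_one, map_smul, map_smul, h1, h1']
  | add a b _ _ ha hb => rw [map_add, map_add, ha, hb]
  | mul a b _ _ ha hb => rw [hD, hD', ha, hb]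

theorem adjoin_field : Algebra.adjoin ℂ (range field) = ⊤ := by
  have hstar : star (range semicircular) = range semicircular := by
    ext Y
    constructor
    · rintro ⟨h, hh⟩
      refine ⟨h, ?_⟩
      rw [← star_star Y, ← hh, (semicircular_isSelfAdjoint h).star_eq]
    · rintro ⟨h, rfl⟩
      exact ⟨h, ((semicircular_isSelfAdjoint h).star_eq).symm⟩
  have hmap : (Algebra.adjoin ℂ (range field)).map SCalg.toSubalgebra.val = SCalg.toSubalgebra := by
    rw [AlgHom.map_adjoin, ← range_comp]
    have : (SCalg.toSubalgebra.val ∘ field) = semicircular := rfl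
    rw [this, StarAlgebra.adjoin_toSubalgebra, hstar, union_self]
  rw [eq_top_iff]
  intro X _
  have hX : (X : Fock →L[ℂ] Fock) ∈ (Algebra.adjoin ℂ (range field)).map SCalg.toSubalgebra.val := by
    rw [hmap]; exact X.2
  obtain ⟨Y, hY, hYX⟩ := hX
  rwa [← Subtype.ext hYX]

theorem IsMalliavinDerivation.unique {D D' : SCalg →ₗ[ℂ] HilbertC ⊗[ℂ] (SCalg ⊗[ℂ] SCalg)}
    (hD : IsMalliavinDerivation D) (hD' : IsMalliavinDerivation D') : D = D' := by
  refine derivation_unique adjoin_field ?_ hD.leibniz hD'.leibniz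
  rintro _ ⟨h, rfl⟩
  exact (hD.map_field h).trans (hD'.map_field h).symm

open Classical in
/-- The free Malliavin derivative on `𝒮𝒞_alg`: the unique derivation with `∇ S(h) = h · 1 ⊗ 1`
(for uniqueness see `IsMalliavinDerivation.unique`). -/
def gradient : SCalg →ₗ[ℂ] HilbertC ⊗[ℂ] (SCalg ⊗[ℂ] SCalg) :=
  if h : ∃ D, IsMalliavinDerivation D then h.choose else 0

/-- `L²(𝒮𝒞^{⊗ k}, τ^{⊗ k})`, the `k`-th Hilbert space tensor power of `L²(𝒮𝒞, τ)`. Since the latter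
is an `L²`-space of functions on `⨆ₙ ℝ₊ⁿ`, this is the `L²`-space of the `k`-fold product measure,
with `(φ₁ ⊗ ⋯ ⊗ φₖ)(x₁, …, xₖ) = φ₁(x₁) ⋯ φₖ(xₖ)`. -/
abbrev Legs (k : ℕ) : Type := Lp ℂ 2 (Measure.pi fun _ : Fin k => confMeasure)

/-- The tensor product `L²(Y) × L²(Yⁿ; E) → L²(Yⁿ⁺¹; E)`,
`(h ⊗ U)(y, y₁, …, yₙ) = h(y) U(y₁, …, yₙ)`. -/
def consTensor {Y : Type*} [MeasurableSpace Y] (μ : Measure Y) [SigmaFinite μ]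
    (E : Type*) [NormedAddCommGroup E] [NormedSpace ℂ E] (n : ℕ) :
    Lp ℂ 2 μ →L[ℂ] Lp E 2 (Measure.pi fun _ : Fin n => μ) →L[ℂ]
      Lp E 2 (Measure.pi fun _ : Fin (n + 1) => μ) :=
  (ContinuousLinearMap.compL ℂ (Lp E 2 (Measure.pi fun _ : Fin n => μ))
    (Lp E 2 (μ.prod (Measure.pi fun _ : Fin n => μ)))
    (Lp E 2 (Measure.pi fun _ : Fin (n + 1) => μ))
    (extendZero (consEquiv Y n) (consEquiv Y n).measurableEmbedding
      (consEquiv_map μ n)).toContinuousLinearMap).comp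
    (tensorLp μ (Measure.pi fun _ : Fin n => μ))

/-- `L²(ℝ₊ⁿ; L²(𝒮𝒞^{⊗ (n + 1)}))`. -/
abbrev RandomField (n : ℕ) : Type :=
  Lp (Legs (n + 1)) 2 (volume : Measure (Fin n → ℝ≥0))

/-- The action `(L, U) ↦ L ∘ U` of bounded operators on vector valued `L²`-functions. -/
def compBilin {X : Type*} [MeasurableSpace X] (μ : Measure X) (E F : Type*)
    [NormedAddCommGroup E] [NormedSpace ℂ E] [NormedAddCommGroup F] [NormedSpace ℂ F] :
    (E →L[ℂ] F) →ₗ[ℂ] Lp E 2 μ →ₗ[ℂ] Lp F 2 μ :=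
  LinearMap.mk₂ ℂ (fun L U => L.compLp U)
    (fun L L' U => ContinuousLinearMap.add_compLp L L' U)
    (fun c L U => ContinuousLinearMap.smul_compLp c L U)
    (fun L U U' => map_add (L.compLpₗ 2 μ) U U')
    (fun c L U => map_smul (L.compLpₗ 2 μ) c U)

/-- The bilinear map `(A, U) ↦ (t ↦ A ⊗ U(t))`. -/
def attachLeg (n : ℕ) : SCalg →ₗ[ℂ] RandomField n →ₗ[ℂ]
    Lp (Legs (n + 2)) 2 (volume : Measure (Fin n → ℝ≥0)) :=
  compBilin volume (Legs (n + 1)) (Legs (n + 2)) ∘ₗ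
    (consTensor confMeasure ℂ (n + 1)).toLinearMap ∘ₗ toVector

/-- The linear map `L²(ℝ₊) ⊙ 𝒮𝒞_alg ⊙ L²(ℝ₊ⁿ; L²(𝒮𝒞^{⊗ (n + 1)})) → L²(ℝ₊ⁿ⁺¹; L²(𝒮𝒞^{⊗ (n + 2)}))`
sending `h ⊗ A ⊗ U` to `(t₁, …, tₙ₊₁) ↦ h(t₁) A ⊗ U(t₂, …, tₙ₊₁)`. -/
def glue (n : ℕ) : HilbertC ⊗[ℂ] (SCalg ⊗[ℂ] RandomField n) →ₗ[ℂ] RandomField (n + 1) :=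
  TensorProduct.lift (consTensor (volume : Measure ℝ≥0) (Legs (n + 2)) n).toLinearMap₁₂ ∘ₗ
    LinearMap.lTensor HilbertC (TensorProduct.lift (attachLeg n))

instance isFiniteMeasure_pi_zero {Y : Type*} [MeasurableSpace Y] (μ : Measure Y) [SigmaFinite μ] :
    IsFiniteMeasure (Measure.pi fun _ : Fin 0 => μ) := by
  rw [Measure.pi_of_empty]; infer_instance

instance isFiniteMeasure_volume_zero : IsFiniteMeasure (volume : Measure (Fin 0 → ℝ≥0)) :=
  inferInstanceAs (IsFiniteMeasure (Measure.pi fun _ : Fin 0 => (volume : Measure ℝ≥0)))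

/-- The iterated free Malliavin derivative on `𝒮𝒞_alg`:
`∇ⁿ = (id^{⊗ (n - 1)} ⊗ ∇_{tₙ}) ∘ ⋯ ∘ (id ⊗ ∇_{t₂}) ∘ ∇_{t₁}`, that is `∇⁰ = id` and
`∇ⁿ⁺¹ = (id ⊗ ∇ⁿ_{t₂, …, tₙ₊₁}) ∘ ∇_{t₁}`. -/
def iterGradient : (n : ℕ) → SCalg →ₗ[ℂ] RandomField n
  | 0 => (Lp.constₗ 2 (volume : Measure (Fin 0 → ℝ≥0)) ℂ).comp
      (((consTensor confMeasure ℂ 0).flip (Lp.const 2 _ 1) : Fock →L[ℂ] Legs 1) ∘ₗ toVector)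
  | n + 1 => glue n ∘ₗ LinearMap.lTensor HilbertC (LinearMap.lTensor SCalg (iterGradient n)) ∘ₗ
      gradient

/-- `∇ᵖ` as an unbounded operator on `L²(𝒮𝒞, τ)` with domain `𝒮𝒞_alg`. -/
def malliavinAlg (p : ℕ) : Fock →ₗ.[ℂ] RandomField p :=
  (LinearMap.range (toVector.prod (iterGradient p))).toLinearPMap

/-- The closure of `∇ᵖ`; its domain is the Sobolev space `𝔻^{p,2}`. -/
def malliavin (p : ℕ) : Fock →ₗ.[ℂ] RandomField p := (malliavinAlg p).closure

/-- The multiple Wigner integral `Iₙ : L²(ℝ₊ⁿ) → L²(𝒮𝒞, τ)`, a linear isometry. It is determined by its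
values on indicators of rectangles off the diagonals, which are the products of increments of the
free Brownian motion: see `wignerIntegral_rectangle`. -/
def wignerIntegral (n : ℕ) : Lp ℂ 2 (volume : Measure (Fin n → ℝ≥0)) →ₗᵢ[ℂ] Fock :=
  extendZero (toConf n) (measurableEmbedding_mk n) (map_mk n)

/-- The finite Wigner chaos `𝒫ₙ` of order `n`: the closed subspace of `L²(𝒮𝒞, τ)` generated by the
products `S(h₁) ⋯ S(hₖ)` with `0 ≤ k ≤ n`. -/
def finiteChaos (n : ℕ) : Submodule ℂ Fock :=
  (Submodule.span ℂ {F | ∃ k ≤ n, ∃ h : Fin k → Lp ℝ 2 (volume : Measure ℝ≥0),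
    F = toVector (List.ofFn fun i => field (h i)).prod}).topologicalClosure

/-- `(s₁, …, sₖ) ↦` the `k`-tuple of points of `⨆ₙ ℝ₊ⁿ`, where `sⱼ ∈ ℝ₊^{m j}`. -/
def toConfs {k : ℕ} (m : Fin k → ℕ) (s : ∀ j, Fin (m j) → ℝ≥0) (j : Fin k) : Conf :=
  toConf (m j) (s j)

theorem measurableEmbedding_toConfs {k : ℕ} (m : Fin k → ℕ) :
    MeasurableEmbedding (toConfs m) := by
  have h (j) := measurableEmbedding_mk (m j)
  refine MeasurableEmbedding.of_measurable_inverse (g := fun c j => (h j).invFun (c j)) ?_ ?_ ?_ ?_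
  · exact measurable_pi_lambda _ fun j => (h j).measurable.comp (measurable_pi_apply j)
  · have : range (toConfs m) = univ.pi fun j => range (toConf (m j)) := by
      ext c
      simp only [mem_range, mem_univ_pi]
      constructor
      · rintro ⟨s, rfl⟩ j
        exact ⟨s j, rfl⟩
      · intro hc
        choose s hs using hc
        exact ⟨s, funext hs⟩
    rw [this]
    exact MeasurableSet.univ_pi fun j => (h j).measurableSet_range
  · exact measurable_pi_lambda _ fun j => (h j).measurable_invFun.comp (measurable_pi_apply j)
  · intro s
    funext j
    exact (h j).leftInverse_invFun (s j)

theorem toConfs_map {k : ℕ} (m : Fin k → ℕ) :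
    (volume : Measure (∀ j, Fin (m j) → ℝ≥0)).map (toConfs m) =
      (Measure.pi fun _ : Fin k => confMeasure).restrict (range (toConfs m)) := by
  have : range (toConfs m) = univ.pi fun j => range (toConf (m j)) := by
    ext c
    simp only [mem_range, mem_univ_pi]
    constructor
    · rintro ⟨s, rfl⟩ j
      exact ⟨s j, rfl⟩
    · intro hc
      choose s hs using hc
      exact ⟨s, funext hs⟩
  have hs (j) : SigmaFinite ((volume : Measure (Fin (m j) → ℝ≥0)).map (toConf (m j))) :=
    (measurableEmbedding_mk (m j)).sigmaFinite_map
  rw [this, Measure.restrict_pi_pi]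
  simp only [← map_mk]
  exact Measure.pi_map_pi fun j => (measurableEmbedding_mk (m j)).measurable.aemeasurable

/-- The map `I_{m 1} ⊗ ⋯ ⊗ I_{m k} : L²(ℝ₊^{m 1} × ⋯ × ℝ₊^{m k}) → L²(𝒮𝒞^{⊗ k})`, a linear isometry,
whose values on elementary tensors are `I_{m 1}(f₁) ⊗ ⋯ ⊗ I_{m k}(fₖ)`: see
`tensorIntegral_prod`. -/
def tensorIntegral {k : ℕ} (m : Fin k → ℕ) :
    Lp ℂ 2 (volume : Measure (∀ j, Fin (m j) → ℝ≥0)) →ₗᵢ[ℂ] Legs k :=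
  extendZero (toConfs m) (measurableEmbedding_toConfs m) (toConfs_map m)

section Slots

variable {n p : ℕ}

/-- For positions `i₁ < ⋯ < iₚ` in `{0, …, n - 1}`, the first index of the `j`-th block of remaining
positions: `0` for `j = 0` and `iⱼ + 1` for `j ≥ 1`. -/
def blockStart (i : Fin p ↪o Fin n) (j : Fin (p + 1)) : ℕ :=
  Fin.cases 0 (fun q => (i q : ℕ) + 1) j

/-- The end (exclusive) of the `j`-th block: `iⱼ₊₁` for `j < p` and `n` for `j = p`. -/
def blockEnd (i : Fin p ↪o Fin n) (j : Fin (p + 1)) : ℕ :=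
  Fin.lastCases n (fun q => (i q : ℕ)) j

/-- The block lengths `i₁ - 1, i₂ - i₁ - 1, …, n - iₚ` (with positions counted from `1`). -/
def blockLength (i : Fin p ↪o Fin n) (j : Fin (p + 1)) : ℕ := blockEnd i j - blockStart i j

theorem blockEnd_le (i : Fin p ↪o Fin n) (j : Fin (p + 1)) : blockEnd i j ≤ n := by
  induction j using Fin.lastCases with
  | last => simp [blockEnd]
  | cast q => simp [blockEnd, (i q).2.le]

/-- The position of the `k`-th variable of the `j`-th block. -/
def blockPos (i : Fin p ↪o Fin n) (x : Σ j, Fin (blockLength i j)) : Fin n :=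
  ⟨blockStart i x.1 + x.2, by
    have h1 := x.2.2
    have h2 := blockEnd_le i x.1
    unfold blockLength at h1
    omega⟩

/-- The point of `ℝ₊ⁿ` which has `t₁, …, tₚ` in the slots `i₁ < ⋯ < iₚ`, and the blocks of `s`, in
order, in the remaining slots. -/
def insertAt (i : Fin p ↪o Fin n) (t : Fin p → ℝ≥0) (s : ∀ j, Fin (blockLength i j) → ℝ≥0) :
    Fin n → ℝ≥0 :=
  Function.extend i t (Function.extend (blockPos i) (fun x => s x.1 x.2) 0)

theorem blockStart_gt (i : Fin p ↪o Fin n) {j : Fin (p + 1)} {q : Fin p} (h : q.castSucc < j) :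
    (i q : ℕ) < blockStart i j := by
  induction j using Fin.cases with
  | zero => exact absurd h (Fin.not_lt_zero _)
  | succ r =>
    have : i q ≤ i r := i.monotone (Fin.castSucc_lt_succ_iff.1 h)
    simpa [blockStart, Nat.lt_succ_iff] using this

theorem le_of_blockEnd (i : Fin p ↪o Fin n) {j : Fin (p + 1)} {q : Fin p} (h : j ≤ q.castSucc) :
    blockEnd i j ≤ (i q : ℕ) := by
  induction j using Fin.lastCases with
  | last => exact absurd h (not_le.2 (Fin.castSucc_lt_last q))
  | cast r =>
    have : i r ≤ i q := i.monotone (Fin.castSucc_le_castSucc_iff.1 h)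
    simpa [blockEnd] using this

theorem blockPos_lt (i : Fin p ↪o Fin n) (x : Σ j, Fin (blockLength i j)) :
    (blockPos i x : ℕ) < blockEnd i x.1 := by
  have h1 := x.2.2
  unfold blockLength at h1
  simp only [blockPos]
  omega

theorem blockPos_ne (i : Fin p ↪o Fin n) (x : Σ j, Fin (blockLength i j)) (q : Fin p) :
    i q ≠ blockPos i x := by
  intro h
  have h' : (i q : ℕ) = blockPos i x := congrArg Fin.val h
  rcases lt_or_ge q.castSucc x.1 with hq | hq
  · have := blockStart_gt i hq
    simp only [blockPos] at h'
    omega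
  · have h1 := le_of_blockEnd i hq
    have h2 := blockPos_lt i x
    omega

theorem blockPos_injective (i : Fin p ↪o Fin n) : Function.Injective (blockPos i) := by
  have key : ∀ x y : Σ j, Fin (blockLength i j), x.1 < y.1 → blockPos i x ≠ blockPos i y := by
    intro x y hxy h
    have h' : (blockPos i x : ℕ) = blockPos i y := congrArg Fin.val h
    have hx : x.1 ≠ Fin.last p := (hxy.trans_le (Fin.le_last _)).ne
    obtain ⟨q, hq⟩ := Fin.exists_castSucc_eq.2 hx
    have h1 := le_of_blockEnd i hq.ge
    have h2 := blockPos_lt i x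
    have h3 := blockStart_gt i (hq.trans_lt hxy)
    simp only [blockPos] at h' h2
    omega
  rintro ⟨j, k⟩ ⟨j', k'⟩ h
  rcases lt_trichotomy j j' with hj | hj | hj
  · exact absurd h (key _ _ hj)
  · subst hj
    have h' : blockStart i j + (k : ℕ) = blockStart i j + k' := congrArg Fin.val h
    have : k = k' := Fin.ext (by omega)
    rw [this]
  · exact absurd h.symm (key _ _ hj)

theorem insertAt_slot (i : Fin p ↪o Fin n) (t : Fin p → ℝ≥0)
    (s : ∀ j, Fin (blockLength i j) → ℝ≥0) (q : Fin p) : insertAt i t s (i q) = t q :=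
  i.injective.extend_apply _ _ _

theorem insertAt_block (i : Fin p ↪o Fin n) (t : Fin p → ℝ≥0)
    (s : ∀ j, Fin (blockLength i j) → ℝ≥0) (j : Fin (p + 1)) (k : Fin (blockLength i j)) :
    insertAt i t s (blockPos i ⟨j, k⟩) = s j k := by
  rw [insertAt, Function.extend_apply' _ _ _ fun ⟨q, hq⟩ => blockPos_ne i _ q hq]
  exact (blockPos_injective i).extend_apply _ _ _

theorem slot_or_block (i : Fin p ↪o Fin n) (l : Fin n) : l ∈ range i ∨ l ∈ range (blockPos i) := by
  by_cases hl : l ∈ range i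
  · exact Or.inl hl
  refine Or.inr ?_
  obtain ⟨j, hj, hmax⟩ := (Finset.univ.filter fun j => blockStart i j ≤ l).exists_maximal
    ⟨0, Finset.mem_filter.2 ⟨Finset.mem_univ _, Nat.zero_le _⟩⟩
  have hj' : blockStart i j ≤ l := by simpa using hj
  have hlt : (l : ℕ) < blockEnd i j := by
    induction j using Fin.lastCases with
    | last => simp [blockEnd]
    | cast r =>
      have h1 : ¬ blockStart i r.succ ≤ l := fun h =>
        absurd (hmax (by simpa using h) (Fin.castSucc_lt_succ).le) (not_le.2 Fin.castSucc_lt_succ)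
      have h2 : (i r : ℕ) ≠ l := fun h => hl ⟨r, Fin.ext h⟩
      simp only [blockStart, Fin.cases_succ] at h1
      simp only [blockEnd, Fin.lastCases_castSucc]
      omega
  refine ⟨⟨j, ⟨l - blockStart i j, ?_⟩⟩, Fin.ext ?_⟩
  · unfold blockLength
    omega
  · simp only [blockPos]
    omega

end Slots

section Evaluation

theorem ae_toConf {P : Conf → Prop} (h : ∀ᵐ x ∂confMeasure, P x) (n : ℕ) :
    ∀ᵐ s ∂(volume : Measure (Fin n → ℝ≥0)), P (toConf n s) := by
  refine (measurableEmbedding_mk n).ae_map_iff.1 ?_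
  rw [map_mk]
  exact ae_restrict_of_ae h

theorem ae_conf {P : Conf → Prop} (h : ∀ n, ∀ᵐ s ∂(volume : Measure (Fin n → ℝ≥0)), P (toConf n s)) :
    ∀ᵐ x ∂confMeasure, P x := by
  rw [confMeasure, Measure.ae_sum_iff]
  exact fun n => (measurableEmbedding_mk n).ae_map_iff.2 (h n)

theorem Fock.ext {φ ψ : Fock} (h : ∀ n, ∀ᵐ s ∂(volume : Measure (Fin n → ℝ≥0)),
    φ (toConf n s) = ψ (toConf n s)) : φ = ψ :=
  Lp.ext (ae_conf h)

theorem vacuum_zero : ∀ᵐ s ∂(volume : Measure (Fin 0 → ℝ≥0)), vacuum (toConf 0 s) = 1 := by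
  filter_upwards [ae_toConf (indicatorConstLp_coeFn (p := 2) (μ := confMeasure)
    (hs := (measurableEmbedding_mk 0).measurableSet_range)
    (hμs := by rw [← image_univ, confMeasure_image]; simp [volume_pi]) (c := (1 : ℂ))) 0] with s hs
  exact hs.trans (indicator_of_mem (mem_range_self s) _)

theorem vacuum_succ (n : ℕ) :
    ∀ᵐ s ∂(volume : Measure (Fin (n + 1) → ℝ≥0)), vacuum (toConf (n + 1) s) = 0 := by
  filter_upwards [ae_toConf (indicatorConstLp_coeFn (p := 2) (μ := confMeasure)
    (hs := (measurableEmbedding_mk 0).measurableSet_range)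
    (hμs := by rw [← image_univ, confMeasure_image]; simp [volume_pi]) (c := (1 : ℂ))) (n + 1)]
    with s hs
  refine hs.trans (indicator_of_notMem ?_ _)
  rintro ⟨y, hy⟩
  exact absurd (congrArg Sigma.fst hy).symm (Nat.succ_ne_zero n)

theorem consEquiv_tail {Y : Type*} [MeasurableSpace Y] {n : ℕ} (s : Fin (n + 1) → Y) :
    consEquiv Y n (s 0, Fin.tail s) = s := by
  rw [consEquiv_apply]
  exact Fin.cons_self_tail s

theorem ae_cons {Y : Type*} [MeasurableSpace Y] {μ : Measure Y} [SigmaFinite μ] {n : ℕ}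
    {P : Y × (Fin n → Y) → Prop} (h : ∀ᵐ z ∂(μ.prod (Measure.pi fun _ => μ)), P z) :
    ∀ᵐ s ∂(Measure.pi fun _ : Fin (n + 1) => μ), P (s 0, Fin.tail s) := by
  rw [← (measurePreserving_consEquiv μ n).map_eq,
    (consEquiv Y n).measurableEmbedding.ae_map_iff]
  filter_upwards [h] with z hz
  simpa using hz

theorem consTensor_apply {Y : Type*} [MeasurableSpace Y] (μ : Measure Y) [SigmaFinite μ]
    {E : Type*} [NormedAddCommGroup E] [NormedSpace ℂ E] {n : ℕ} (h : Lp ℂ 2 μ)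
    (U : Lp E 2 (Measure.pi fun _ : Fin n => μ)) :
    ∀ᵐ s ∂(Measure.pi fun _ : Fin (n + 1) => μ),
      consTensor μ E n h U s = h (s 0) • U (Fin.tail s) := by
  filter_upwards [coeFn_extendZero (consEquiv Y n) (consEquiv Y n).measurableEmbedding
    (consEquiv_map μ n) (tensorLp μ (Measure.pi fun _ : Fin n => μ) h U),
    ae_cons (coeFn_tensorLp h U)] with s h1 h2
  refine h1.trans ?_
  conv_lhs => rw [← consEquiv_tail s]
  rw [(consEquiv Y n).injective.extend_apply, h2]

/-- `(l(h) φ)(t, s₁, …, sₙ) = h(t) φ(s₁, …, sₙ)`. -/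
theorem creation_succ (h : HilbertC) (φ : Fock) (n : ℕ) :
    ∀ᵐ s ∂(volume : Measure (Fin (n + 1) → ℝ≥0)),
      creation h φ (toConf (n + 1) s) = h (s 0) * φ (toConf n (Fin.tail s)) := by
  have h0 := coeFn_tensorLp h φ (ν := (volume : Measure ℝ≥0)) (μ := confMeasure)
  have h1 : ∀ᵐ z ∂((volume : Measure ℝ≥0).prod (Measure.pi fun _ : Fin n => volume)),
      tensorLp volume confMeasure h φ (z.1, toConf n z.2) = h z.1 • φ (toConf n z.2) := by
    have h2 : ∀ᵐ z ∂(((volume : Measure ℝ≥0).prod (volume : Measure (Fin n → ℝ≥0))).map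
        (Prod.map id (toConf n))), tensorLp volume confMeasure h φ z = h z.1 • φ z.2 := by
      rw [← Measure.map_prod_map _ _ measurable_id (measurableEmbedding_mk n).measurable,
        Measure.map_id, map_mk]
      refine Measure.AbsolutelyContinuous.ae_le ?_ h0
      exact Measure.AbsolutelyContinuous.rfl.prod Measure.restrict_le_self.absolutelyContinuous
    exact (measurableEmbedding_idMk n).ae_map_iff.1 h2
  filter_upwards [ae_toConf (coeFn_extendZero consConf measurableEmbedding_consConf consConf_map
    (tensorLp volume confMeasure h φ)) (n + 1), ae_cons h1] with s h3 h4
  rw [creation_apply, h3]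
  have : toConf (n + 1) s = consConf (s 0, toConf n (Fin.tail s)) := by simp [consConf, toConf]
  rw [this, measurableEmbedding_consConf.injective.extend_apply]
  exact h4

theorem creation_zero (h : HilbertC) (φ : Fock) :
    ∀ᵐ s ∂(volume : Measure (Fin 0 → ℝ≥0)), creation h φ (toConf 0 s) = 0 := by
  filter_upwards [ae_toConf (coeFn_extendZero consConf measurableEmbedding_consConf consConf_map
    (tensorLp volume confMeasure h φ)) 0] with s h3
  rw [creation_apply, h3, Function.extend_apply']
  · rfl
  · rintro ⟨y, hy⟩
    exact absurd (congrArg Sigma.fst hy) (Nat.succ_ne_zero _)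

theorem wignerIntegral_self (n : ℕ) (f : Lp ℂ 2 (volume : Measure (Fin n → ℝ≥0))) :
    ∀ᵐ s ∂(volume : Measure (Fin n → ℝ≥0)), wignerIntegral n f (toConf n s) = f s := by
  filter_upwards [ae_toConf (coeFn_extendZero (toConf n) (measurableEmbedding_mk n) (map_mk n) f) n]
    with s hs
  exact hs.trans ((toConf_injective n).extend_apply _ _ _)

theorem wignerIntegral_ne {n k : ℕ} (hk : k ≠ n) (f : Lp ℂ 2 (volume : Measure (Fin n → ℝ≥0))) :
    ∀ᵐ s ∂(volume : Measure (Fin k → ℝ≥0)), wignerIntegral n f (toConf k s) = 0 := by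
  filter_upwards [ae_toConf (coeFn_extendZero (toConf n) (measurableEmbedding_mk n) (map_mk n) f) k]
    with s hs
  refine hs.trans (Function.extend_apply' _ _ _ ?_)
  rintro ⟨y, hy⟩
  exact hk (congrArg Sigma.fst hy).symm

theorem inner_creation (h k : HilbertC) (φ ψ : Fock) :
    inner ℂ (creation h φ) (creation k ψ) = inner ℂ h k * inner ℂ φ ψ := by
  rw [creation_apply, creation_apply, LinearIsometry.inner_map_map, inner_tensorLp]

theorem annihilation_creation (h k : HilbertC) (φ : Fock) :
    ContinuousLinearMap.adjoint (creation h) (creation k φ) = (inner ℂ h k : ℂ) • φ := by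
  refine ext_inner_left ℂ fun ψ => ?_
  rw [ContinuousLinearMap.adjoint_inner_right, inner_creation, inner_smul_right]

theorem annihilation_vacuum (h : HilbertC) :
    ContinuousLinearMap.adjoint (creation h) vacuum = 0 := by
  refine ext_inner_left ℂ fun ψ => ?_
  rw [ContinuousLinearMap.adjoint_inner_right, inner_zero_right, L2.inner_def]
  refine integral_eq_zero_of_ae (ae_conf fun n => ?_)
  cases n with
  | zero => filter_upwards [creation_zero h ψ] with s hs; simp [hs]
  | succ n => filter_upwards [vacuum_succ n] with s hs; simp [hs]

/-- `Iₙ₊₁(h ⊗ g) Ω = l(h) Iₙ(g) Ω`. -/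
theorem wignerIntegral_cons {n : ℕ} (h : HilbertC) (g : Lp ℂ 2 (volume : Measure (Fin n → ℝ≥0)))
    (f : Lp ℂ 2 (volume : Measure (Fin (n + 1) → ℝ≥0)))
    (hf : ∀ᵐ s ∂(volume : Measure (Fin (n + 1) → ℝ≥0)), f s = h (s 0) * g (Fin.tail s)) :
    wignerIntegral (n + 1) f = creation h (wignerIntegral n g) := by
  refine Fock.ext fun k => ?_
  cases k with
  | zero =>
    filter_upwards [wignerIntegral_ne (Nat.succ_ne_zero n).symm f,
      creation_zero h (wignerIntegral n g)] with s h1 h2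
    rw [h1, h2]
  | succ k =>
    by_cases hk : k = n
    · subst hk
      have h5 : ∀ᵐ z ∂((volume : Measure ℝ≥0).prod (Measure.pi fun _ : Fin k => volume)),
          wignerIntegral k g (toConf k z.2) = g z.2 :=
        Measure.quasiMeasurePreserving_snd.ae (wignerIntegral_self k g)
      filter_upwards [wignerIntegral_self (k + 1) f, hf,
        creation_succ h (wignerIntegral k g) k, ae_cons h5] with s h1 h2 h3 h4
      rw [h1, h2, h3, h4]
    · have h5 : ∀ᵐ z ∂((volume : Measure ℝ≥0).prod (Measure.pi fun _ : Fin k => volume)),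
          wignerIntegral n g (toConf k z.2) = 0 :=
        Measure.quasiMeasurePreserving_snd.ae (wignerIntegral_ne hk _)
      filter_upwards [wignerIntegral_ne (fun h => hk (Nat.succ_injective h)) f,
        creation_succ h (wignerIntegral n g) k, ae_cons h5] with s h1 h3 h4
      rw [h1, h3, h4, mul_zero]

theorem wignerIntegral_zero (f : Lp ℂ 2 (volume : Measure (Fin 0 → ℝ≥0)))
    (hf : ∀ᵐ s ∂(volume : Measure (Fin 0 → ℝ≥0)), f s = 1) : wignerIntegral 0 f = vacuum := by
  refine Fock.ext fun k => ?_
  cases k with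
  | zero =>
    filter_upwards [wignerIntegral_self 0 f, vacuum_zero, hf] with s h1 h2 h3
    rw [h1, h2, h3]
  | succ k =>
    filter_upwards [wignerIntegral_ne (Nat.succ_ne_zero k) f, vacuum_succ k] with s h1 h2
    rw [h1, h2]

theorem memLp_prod (n : ℕ) (h : Fin n → HilbertC) :
    MemLp (fun s : Fin n → ℝ≥0 => ∏ i, h i (s i)) 2 volume := by
  induction n with
  | zero => simp
  | succ n ih =>
    refine (Lp.memLp (consTensor volume ℂ n (h 0) (ih fun i => h i.succ).toLp)).ae_eq ?_
    have h5 : ∀ᵐ z ∂((volume : Measure ℝ≥0).prod (Measure.pi fun _ : Fin n => volume)),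
        (ih fun i => h i.succ).toLp _ z.2 = ∏ i, h i.succ (z.2 i) :=
      Measure.quasiMeasurePreserving_snd.ae (ih fun i => h i.succ).coeFn_toLp
    filter_upwards [consTensor_apply volume (h 0) (ih fun i => h i.succ).toLp, ae_cons h5]
      with s h1 h2
    rw [h1, h2, Fin.prod_univ_succ]
    rfl

/-- For pairwise orthogonal `h₁, …, hₙ ∈ L²(ℝ₊; ℝ)`, `Iₙ(h₁ ⊗ ⋯ ⊗ hₙ) = S(h₁) ⋯ S(hₙ)`. -/
theorem wignerIntegral_of_orthogonal (n : ℕ) (h : Fin n → Lp ℝ 2 (volume : Measure ℝ≥0))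
    (horth : ∀ i j, i ≠ j → inner ℂ (complexify (h i)) (complexify (h j)) = (0 : ℂ))
    (f : Lp ℂ 2 (volume : Measure (Fin n → ℝ≥0)))
    (hf : ∀ᵐ s ∂(volume : Measure (Fin n → ℝ≥0)), f s = ∏ i, complexify (h i) (s i)) :
    wignerIntegral n f = toVector (List.ofFn fun i => field (h i)).prod := by
  suffices H : wignerIntegral n f = toVector (List.ofFn fun i => field (h i)).prod ∧
      (∀ k : HilbertC, (∀ i, inner ℂ k (complexify (h i)) = (0 : ℂ)) →
        ContinuousLinearMap.adjoint (creation k) (wignerIntegral n f) = 0) from H.1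
  induction n with
  | zero =>
    have h0 : wignerIntegral 0 f = vacuum := wignerIntegral_zero f (by simpa using hf)
    refine ⟨?_, fun k _ => ?_⟩
    · rw [h0]; simp [toVector]
    · rw [h0, annihilation_vacuum]
  | succ n ih =>
    have hg : MemLp (fun s : Fin n → ℝ≥0 => ∏ i, complexify (h i.succ) (s i)) 2 volume :=
      memLp_prod n _
    have hcr : wignerIntegral (n + 1) f =
        creation (complexify (h 0)) (wignerIntegral n hg.toLp) := by
      refine wignerIntegral_cons _ _ _ ?_
      have h5 : ∀ᵐ z ∂((volume : Measure ℝ≥0).prod (Measure.pi fun _ : Fin n => volume)),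
          hg.toLp _ z.2 = ∏ i, complexify (h i.succ) (z.2 i) :=
        Measure.quasiMeasurePreserving_snd.ae hg.coeFn_toLp
      filter_upwards [hf, ae_cons h5] with s h1 h2
      rw [h1, h2, Fin.prod_univ_succ]
      rfl
    obtain ⟨ih1, ih2⟩ := ih (fun i => h i.succ)
      (fun i j hij => horth _ _ (fun h => hij (Fin.succ_injective _ h))) hg.toLp hg.coeFn_toLp
    refine ⟨?_, fun k hk => ?_⟩
    · rw [List.ofFn_succ, List.prod_cons]
      change _ = semicircular (h 0) (toVector (List.ofFn fun i : Fin n => field (h i.succ)).prod)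
      rw [← ih1, semicircular, add_apply,
        ih2 _ fun i => horth _ _ (Fin.succ_ne_zero i).symm, add_zero, hcr]
    · rw [hcr, annihilation_creation, hk 0, zero_smul]

end Evaluation

section Rectangles

theorem complexify_sub (h k : Lp ℝ 2 (volume : Measure ℝ≥0)) :
    complexify (h - k) = complexify h - complexify k :=
  map_sub (Complex.ofRealCLM.compLpₗ 2 (volume : Measure ℝ≥0)) h k

theorem field_sub (h k : Lp ℝ 2 (volume : Measure ℝ≥0)) : field (h - k) = field h - field k := by
  ext1
  change semicircular (h - k) = semicircular h - semicircular k
  rw [semicircular, semicircular, semicircular, complexify_sub, map_sub, map_sub]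
  abel

theorem volume_Iic_ne_top (t : ℝ≥0) : (volume : Measure ℝ≥0) (Iic t) ≠ ∞ := by
  rw [volume_halfLine]
  refine ((measure_mono (t := Icc (0 : ℝ) t) ?_).trans_lt measure_Icc_lt_top).ne
  rintro _ ⟨x, hx, rfl⟩
  exact ⟨x.2, hx⟩

instance nullSingleton_halfLine : NullSingletonClass (volume : Measure ℝ≥0) := by
  refine ⟨fun x => ?_⟩
  rw [volume_halfLine, image_singleton, measure_singleton]

theorem complexify_indicator {A : Set ℝ≥0} (hA : MeasurableSet A) (hA' : volume A ≠ ∞) :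
    complexify (indicatorConstLp 2 hA hA' 1) =ᵐ[volume] A.indicator 1 := by
  filter_upwards [Complex.ofRealCLM.coeFn_compLp (indicatorConstLp 2 hA hA' (1 : ℝ)),
    indicatorConstLp_coeFn (p := 2) (hs := hA) (hμs := hA') (c := (1 : ℝ))] with x h1 h2
  refine h1.trans ?_
  rw [h2]
  by_cases hx : x ∈ A <;> simp [hx]

/-- The free Brownian motion `S_t = S(1_{[0, t]})`. -/
def brownian (t : ℝ≥0) : SCalg :=
  field (indicatorConstLp 2 measurableSet_Iic (volume_Iic_ne_top t) 1)

theorem volume_Ioc_ne_top (u v : ℝ≥0) : (volume : Measure ℝ≥0) (Ioc u v) ≠ ∞ :=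
  ((measure_mono fun _ hx => hx.2).trans_lt (volume_Iic_ne_top v).lt_top).ne

theorem brownian_sub {u v : ℝ≥0} (huv : u ≤ v) : brownian v - brownian u =
    field (indicatorConstLp 2 measurableSet_Ioc (volume_Ioc_ne_top u v) 1) := by
  rw [brownian, brownian, ← field_sub]
  congr 1
  refine Lp.ext ?_
  filter_upwards [Lp.coeFn_sub
      (indicatorConstLp 2 measurableSet_Iic (volume_Iic_ne_top v) (1 : ℝ))
      (indicatorConstLp 2 measurableSet_Iic (volume_Iic_ne_top u) (1 : ℝ)),
    indicatorConstLp_coeFn (p := 2) (hs := measurableSet_Iic) (hμs := volume_Iic_ne_top v)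
      (c := (1 : ℝ)),
    indicatorConstLp_coeFn (p := 2) (hs := measurableSet_Iic) (hμs := volume_Iic_ne_top u)
      (c := (1 : ℝ)),
    indicatorConstLp_coeFn (p := 2) (hs := measurableSet_Ioc) (hμs := volume_Ioc_ne_top u v)
      (c := (1 : ℝ))] with x h1 h2 h3 h4
  rw [h1, Pi.sub_apply, h2, h3, h4]
  by_cases hx : x ≤ u
  · simp [indicator, hx, hx.trans huv, not_lt.2 hx]
  · by_cases hx' : x ≤ v <;> simp [indicator, hx, hx', not_le.1 hx]

/-- For a rectangle `A = [u₁, v₁] × ⋯ × [uₙ, vₙ]` which does not meet the diagonals, `Iₙ(1_A)` is the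
product of increments `(S_{v₁} - S_{u₁}) ⋯ (S_{vₙ} - S_{uₙ})`. -/
theorem wignerIntegral_rectangle (n : ℕ) (u v : Fin n → ℝ≥0) (huv : u ≤ v)
    (hdiag : ∀ s ∈ Icc u v, Function.Injective s)
    (f : Lp ℂ 2 (volume : Measure (Fin n → ℝ≥0))) (hf : f =ᵐ[volume] (Icc u v).indicator 1) :
    wignerIntegral n f =
      toVector (List.ofFn fun i => brownian (v i) - brownian (u i)).prod := by
  have hd : ∀ i j, i ≠ j → ∀ x, x ∈ Icc (u i) (v i) → x ∉ Icc (u j) (v j) := by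
    intro i j hij x hi hj
    have hmem : Function.update (Function.update u i x) j x ∈ Icc u v := by
      constructor <;> intro l
      · by_cases hl : l = j
        · subst hl; simpa using hj.1
        · by_cases hl' : l = i
          · subst hl'; simpa [hl] using hi.1
          · simp [hl, hl']
      · by_cases hl : l = j
        · subst hl; simpa using hj.2
        · by_cases hl' : l = i
          · subst hl'; simpa [hl] using hi.2
          · simpa [hl, hl'] using huv l
    refine hij (hdiag _ hmem ?_)
    simp [hij]
  simp only [fun i => brownian_sub (huv i)]
  refine wignerIntegral_of_orthogonal n _ (fun i j hij => ?_) f ?_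
  · rw [L2.inner_def]
    refine integral_eq_zero_of_ae ?_
    filter_upwards [complexify_indicator measurableSet_Ioc (volume_Ioc_ne_top (u i) (v i)),
      complexify_indicator measurableSet_Ioc (volume_Ioc_ne_top (u j) (v j))] with x h1 h2
    rw [h1, h2]
    by_cases hx : x ∈ Ioc (u i) (v i)
    · have : x ∉ Ioc (u j) (v j) := fun h =>
        hd i j hij x (Ioc_subset_Icc_self hx) (Ioc_subset_Icc_self h)
      simp [this]
    · simp [hx]
  · have h1 : ∀ᵐ s ∂(volume : Measure (Fin n → ℝ≥0)), ∀ i, s i ≠ u i :=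
      ae_all_iff.2 fun i => Measure.ae_eval_ne (fun _ : Fin n => (volume : Measure ℝ≥0)) i (u i)
    have h2 : ∀ᵐ s ∂(volume : Measure (Fin n → ℝ≥0)), ∀ i,
        complexify (indicatorConstLp 2 measurableSet_Ioc (volume_Ioc_ne_top (u i) (v i)) 1) (s i) =
          (Ioc (u i) (v i)).indicator 1 (s i) :=
      ae_all_iff.2 fun i => (Measure.quasiMeasurePreserving_eval (fun _ : Fin n => (volume : Measure ℝ≥0)) i).ae
        (complexify_indicator measurableSet_Ioc (volume_Ioc_ne_top (u i) (v i)))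
    filter_upwards [hf, h1, h2] with s h3 h4 h5
    rw [h3, Finset.prod_congr rfl fun i _ => h5 i]
    by_cases hs : s ∈ Icc u v
    · rw [indicator_of_mem hs, Finset.prod_eq_one]
      · rfl
      · intro i _
        rw [indicator_of_mem (show s i ∈ Ioc (u i) (v i) from
          ⟨lt_of_le_of_ne (hs.1 i) (h4 i).symm, hs.2 i⟩)]
        rfl
    · rw [indicator_of_notMem hs]
      have : ∃ i, s i ∉ Ioc (u i) (v i) := by
        by_contra! h
        exact hs ⟨fun i => (h i).1.le, fun i => (h i).2⟩
      obtain ⟨i, hi⟩ := this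
      exact (Finset.prod_eq_zero (Finset.mem_univ i) (indicator_of_notMem hi _)).symm

/-- `(I_{m 1} ⊗ ⋯ ⊗ I_{m k})(f₁ ⊗ ⋯ ⊗ fₖ) = I_{m 1}(f₁) ⊗ ⋯ ⊗ I_{m k}(fₖ)`. -/
theorem tensorIntegral_prod {k : ℕ} (m : Fin k → ℕ)
    (f : ∀ j, Lp ℂ 2 (volume : Measure (Fin (m j) → ℝ≥0)))
    (g : Lp ℂ 2 (volume : Measure (∀ j, Fin (m j) → ℝ≥0)))
    (hg : ∀ᵐ s ∂(volume : Measure (∀ j, Fin (m j) → ℝ≥0)), g s = ∏ j, f j (s j)) :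
    ∀ᵐ x ∂(Measure.pi fun _ : Fin k => confMeasure),
      tensorIntegral m g x = ∏ j, wignerIntegral (m j) (f j) (x j) := by
  have h1 : ∀ᵐ x ∂(Measure.pi fun _ : Fin k => confMeasure), ∀ j,
      wignerIntegral (m j) (f j) (x j) = Function.extend (toConf (m j)) (f j) 0 (x j) :=
    ae_all_iff.2 fun j => (Measure.quasiMeasurePreserving_eval (fun _ => confMeasure) j).ae
      (coeFn_extendZero (toConf (m j)) (measurableEmbedding_mk (m j)) (map_mk (m j)) (f j))
  filter_upwards [coeFn_extendZero (toConfs m) (measurableEmbedding_toConfs m) (toConfs_map m) g,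
    h1, extend_ae_congr (measurableEmbedding_toConfs m) (toConfs_map m) hg] with x h2 h3 h4
  refine h2.trans (h4.trans ?_)
  rw [Finset.prod_congr rfl fun j _ => h3 j]
  by_cases hx : ∃ s, toConfs m s = x
  · obtain ⟨s, rfl⟩ := hx
    rw [(measurableEmbedding_toConfs m).injective.extend_apply]
    exact Finset.prod_congr rfl fun j _ => ((toConf_injective (m j)).extend_apply _ _ _).symm
  · rw [Function.extend_apply' _ _ _ hx]
    have : ∃ j, ¬ ∃ s, toConf (m j) s = x j := by
      by_contra! h
      choose s hs using h
      exact hx ⟨s, funext hs⟩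
    obtain ⟨j, hj⟩ := this
    exact (Finset.prod_eq_zero (Finset.mem_univ j) (Function.extend_apply' _ _ _ hj)).symm

end Rectangles

section Cyclic

theorem wignerIntegral_prod_succ {n : ℕ} (h : Fin (n + 1) → HilbertC) :
    wignerIntegral (n + 1) (memLp_prod (n + 1) h).toLp =
      creation (h 0) (wignerIntegral n (memLp_prod n fun i => h i.succ).toLp) := by
  refine wignerIntegral_cons _ _ _ ?_
  have h5 : ∀ᵐ z ∂((volume : Measure ℝ≥0).prod (Measure.pi fun _ : Fin n => volume)),
      (memLp_prod n fun i => h i.succ).toLp _ z.2 = ∏ i, h i.succ (z.2 i) :=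
    Measure.quasiMeasurePreserving_snd.ae (memLp_prod n fun i => h i.succ).coeFn_toLp
  filter_upwards [(memLp_prod (n + 1) h).coeFn_toLp, ae_cons h5] with s h1 h2
  rw [h1, h2, Fin.prod_univ_succ]
  rfl

theorem semicircular_mem {φ : Fock} (h : Lp ℝ 2 (volume : Measure ℝ≥0))
    (hφ : φ ∈ LinearMap.range toVector) : semicircular h φ ∈ LinearMap.range toVector := by
  obtain ⟨X, rfl⟩ := hφ
  exact ⟨field h * X, rfl⟩

theorem wignerIntegral_prod_mem (n : ℕ) (h : Fin n → Lp ℝ 2 (volume : Measure ℝ≥0)) :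
    wignerIntegral n (memLp_prod n fun i => complexify (h i)).toLp ∈ LinearMap.range toVector := by
  suffices H : ∀ n, (∀ h : Fin n → Lp ℝ 2 (volume : Measure ℝ≥0),
      wignerIntegral n (memLp_prod n fun i => complexify (h i)).toLp ∈ LinearMap.range toVector) ∧
      (∀ h : Fin (n + 1) → Lp ℝ 2 (volume : Measure ℝ≥0), wignerIntegral (n + 1)
        (memLp_prod (n + 1) fun i => complexify (h i)).toLp ∈ LinearMap.range toVector) from
    (H n).1 h
  have hvac : vacuum ∈ LinearMap.range toVector := ⟨1, rfl⟩
  have h0 : ∀ h : Fin 0 → Lp ℝ 2 (volume : Measure ℝ≥0),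
      wignerIntegral 0 (memLp_prod 0 fun i => complexify (h i)).toLp = vacuum := fun h =>
    wignerIntegral_zero _ (by
      filter_upwards [(memLp_prod 0 fun i => complexify (h i)).coeFn_toLp] with s hs
      rw [hs]; simp)
  have hcr : ∀ (h : Lp ℝ 2 (volume : Measure ℝ≥0)) (φ : Fock), creation (complexify h) φ =
      semicircular h φ - ContinuousLinearMap.adjoint (creation (complexify h)) φ := fun h φ => by
    rw [semicircular, add_apply, add_sub_cancel_right]
  intro n
  induction n with
  | zero =>
    refine ⟨fun h => by rw [h0]; exact hvac, fun h => ?_⟩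
    rw [wignerIntegral_prod_succ, h0 fun i => h i.succ, hcr, annihilation_vacuum, sub_zero]
    exact semicircular_mem _ hvac
  | succ n ih =>
    refine ⟨ih.2, fun h => ?_⟩
    rw [wignerIntegral_prod_succ, hcr]
    refine sub_mem (semicircular_mem _ (ih.2 _)) ?_
    rw [wignerIntegral_prod_succ, annihilation_creation]
    exact Submodule.smul_mem _ _ (ih.1 _)

theorem eq_zero_of_boxes {n : ℕ} (f : Lp ℂ 2 (volume : Measure (Fin n → ℝ≥0)))
    (hf : ∀ A : Fin n → Set ℝ≥0, (∀ i, MeasurableSet (A i)) → (∀ i, volume (A i) ≠ ∞) →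
      ∫ s in univ.pi A, f s = 0) : f = 0 := by
  set S : ℕ → Set ℝ≥0 := fun N => spanningSets volume N with hS
  set B : ℕ → Set (Fin n → ℝ≥0) := fun N => univ.pi fun _ => S N with hB
  have hBm (N) : MeasurableSet (B N) := MeasurableSet.univ_pi fun _ => measurableSet_spanningSets _ N
  have hBfin (N) : volume (B N) < ∞ := by
    rw [hB, volume_pi, Measure.pi_pi]
    exact ENNReal.prod_lt_top fun i _ => measure_spanningSets_lt_top _ N
  have hcover : ⋃ N, B N = univ := by
    refine eq_univ_of_forall fun s => ?_
    have : ∀ i, ∃ N, s i ∈ S N := fun i => by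
      have : s i ∈ ⋃ N, S N := by rw [hS, iUnion_spanningSets]; trivial
      exact mem_iUnion.1 this
    choose N hN using this
    refine mem_iUnion.2 ⟨Finset.univ.sup N, fun i _ => ?_⟩
    exact monotone_spanningSets volume (Finset.le_sup (f := N) (Finset.mem_univ i)) (hN i)
  have hint (N) : IntegrableOn f (B N) := by
    have : IsFiniteMeasure ((volume : Measure (Fin n → ℝ≥0)).restrict (B N)) :=
      ⟨by simpa using hBfin N⟩
    exact ((Lp.memLp f).restrict (B N)).integrable one_le_two
  have key (N) (s : Set (Fin n → ℝ≥0)) (hs : MeasurableSet s) :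
      ∫ x in s, f x ∂(volume.restrict (B N)) = 0 := by
    induction s, hs using MeasurableSpace.induction_on_inter (generateFrom_pi (ι := Fin n)
      (α := fun _ => ℝ≥0)).symm isPiSystem_pi with
    | empty => simp
    | basic t ht =>
      obtain ⟨A, hA, rfl⟩ := ht
      have hA' : ∀ i, MeasurableSet (A i) := fun i => hA i trivial
      rw [Measure.restrict_restrict (MeasurableSet.univ_pi hA'), hB, ← Set.pi_inter_distrib]
      refine hf _ (fun i => (hA' i).inter (measurableSet_spanningSets _ N)) fun i => ?_
      exact ((measure_mono inter_subset_right).trans_lt (measure_spanningSets_lt_top _ N)).ne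
    | compl t ht ih =>
      have h1 := integral_add_compl ht (hint N)
      rw [ih, zero_add] at h1
      rw [h1, hB]
      exact hf _ (fun i => measurableSet_spanningSets _ N)
        fun i => (measure_spanningSets_lt_top _ N).ne
    | iUnion t hd ht ih =>
      rw [integral_iUnion ht hd (hint N).integrableOn]
      simp [ih]
  refine Lp.ext ?_
  have h2 : ∀ᵐ x ∂(volume : Measure (Fin n → ℝ≥0)).restrict (⋃ N, B N), f x = 0 := by
    rw [ae_restrict_iUnion_iff]
    intro N
    exact (hint N).ae_eq_zero_of_forall_setIntegral_eq_zero fun s hs _ => key N s hs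
  rw [hcover, Measure.restrict_univ] at h2
  filter_upwards [h2, Lp.coeFn_zero ℂ 2 (volume : Measure (Fin n → ℝ≥0))] with x h3 h4
  rw [h3, h4]; rfl

/-- The vacuum vector is cyclic: `𝒮𝒞_alg Ω` is dense, so that the Fock space is the completion of
`𝒮𝒞` with respect to the norm `‖X‖₂ = ‖X Ω‖`. -/
theorem toVector_denseRange : DenseRange toVector := by
  have : (LinearMap.range toVector).topologicalClosure = ⊤ := by
    rw [Submodule.topologicalClosure_eq_top_iff, Submodule.eq_bot_iff]
    intro φ hφ
    rw [Submodule.mem_orthogonal] at hφ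
    refine Fock.ext fun n => ?_
    have hadj : ContinuousLinearMap.adjoint (wignerIntegral n).toContinuousLinearMap φ = 0 := by
      refine eq_zero_of_boxes _ fun A hA hA' => ?_
      have hbox : volume (univ.pi A) ≠ ∞ := by
        rw [volume_pi, Measure.pi_pi]
        exact (ENNReal.prod_lt_top fun i _ => (hA' i).lt_top).ne
      rw [← L2.inner_indicatorConstLp_one (𝕜 := ℂ) (MeasurableSet.univ_pi hA) hbox,
        ContinuousLinearMap.adjoint_inner_right]
      have heq : indicatorConstLp 2 (MeasurableSet.univ_pi hA) hbox (1 : ℂ) =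
          (memLp_prod n fun i => complexify (indicatorConstLp 2 (hA i) (hA' i) 1)).toLp := by
        refine Lp.ext ?_
        have h2 : ∀ᵐ s ∂(volume : Measure (Fin n → ℝ≥0)), ∀ i,
            complexify (indicatorConstLp 2 (hA i) (hA' i) 1) (s i) = (A i).indicator 1 (s i) :=
          ae_all_iff.2 fun i => (Measure.quasiMeasurePreserving_eval (fun _ : Fin n => (volume : Measure ℝ≥0)) i).ae
            (complexify_indicator (hA i) (hA' i))
        filter_upwards [indicatorConstLp_coeFn (p := 2) (hs := MeasurableSet.univ_pi hA)
          (hμs := hbox) (c := (1 : ℂ)), (memLp_prod n fun i =>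
            complexify (indicatorConstLp 2 (hA i) (hA' i) 1)).coeFn_toLp, h2] with s h3 h4 h5
        rw [h3, h4, Finset.prod_congr rfl fun i _ => h5 i]
        by_cases hs : s ∈ univ.pi A
        · rw [indicator_of_mem hs, Finset.prod_eq_one]
          exact fun i _ => indicator_of_mem (hs i trivial) _
        · rw [indicator_of_notMem hs]
          have : ∃ i, s i ∉ A i := by
            by_contra! h
            exact hs fun i _ => h i
          obtain ⟨i, hi⟩ := this
          exact (Finset.prod_eq_zero (Finset.mem_univ i) (indicator_of_notMem hi _)).symm
      rw [heq]
      exact hφ _ (wignerIntegral_prod_mem n fun i => indicatorConstLp 2 (hA i) (hA' i) 1)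
    have hmem : MemLp (fun s => φ (toConf n s)) 2 (volume : Measure (Fin n → ℝ≥0)) := by
      have := (Lp.memLp φ).restrict (range (toConf n))
      rw [← map_mk, (measurableEmbedding_mk n).memLp_map_measure_iff] at this
      exact this
    have h1 : inner ℂ (wignerIntegral n hmem.toLp) φ = (0 : ℂ) := by
      have := ContinuousLinearMap.adjoint_inner_right
        (wignerIntegral n).toContinuousLinearMap hmem.toLp φ
      rw [hadj, inner_zero_right] at this
      exact this.symm
    have h2 : inner ℂ (wignerIntegral n hmem.toLp) (wignerIntegral n hmem.toLp) = (0 : ℂ) := by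
      rw [← h1, L2.inner_def, L2.inner_def]
      refine integral_congr_ae (ae_conf fun k => ?_)
      by_cases hk : k = n
      · subst hk
        filter_upwards [wignerIntegral_self k hmem.toLp, hmem.coeFn_toLp] with s h3 h4
        rw [h3, h4]
      · filter_upwards [wignerIntegral_ne hk hmem.toLp] with s h3
        rw [h3]; simp
    rw [LinearIsometry.inner_map_map, inner_self_eq_zero] at h2
    filter_upwards [hmem.coeFn_toLp, ae_toConf (Lp.coeFn_zero ℂ 2 confMeasure) n,
      Lp.coeFn_zero ℂ 2 (volume : Measure (Fin n → ℝ≥0))] with s h3 h4 h5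
    rw [← h3, h2, h4, h5]; rfl
  intro x
  have hx : x ∈ (LinearMap.range toVector).topologicalClosure := by rw [this]; trivial
  exact hx

end Cyclic

end WignerSpace

end

open WignerSpace

noncomputable section

namespace WignerSpace

/-! The Fock space is an `L²`-space of functions on finite sequences in `ℝ₊`. In these coordinates
`∇ᵖ` is evaluation at a concatenation: `(∇ᵖ φ)(t)(c₀, …, cₚ) = φ(c₀ t₁ c₁ ⋯ tₚ cₚ)`. Both claims
follow from this formula, which is `iterGradient_apply` on `𝒮𝒞_alg` and `agreesWith_malliavin` on
the domain of the closure.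

On the algebra the formula is checked on Wick products. They span `𝒮𝒞_alg` (`span_wick`), their
vectors are the elementary tensors `h₁ ⊗ ⋯ ⊗ hₙ` (`toVector_wick`), and `∇` splits such a word at
each of its letters with no contraction terms (`gradient_wick`). This presupposes that the
derivation exists. It is built on the free algebra and descends to `𝒮𝒞_alg`, because its
coefficients against elementary tensors depend only on the image of the polynomial
(`pairDual_freeDeriv`), and those coefficients separate points since the vacuum is a separating
trace vector.

The analysis rests on one estimate, `lintegral_interleave_le`: integrating `F(c₀ t₁ c₁ ⋯ tₚ cₚ)`
over `t` and `c` costs at most a factor `(length)ᵖ`, because a sequence has at most that many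
choices of `p` cut points. Hence null sets pull back to null sets, so the formula makes sense for
`L²`-classes; the formula passes to limits, so `∇ᵖ` is closable (`graph_malliavin`); and `∇ᵖ` is
bounded on the `n`-th chaos, so `Iₙ(f)` lies in the domain (`wignerIntegral_mem_domain`).

For claim (1), the concatenation has length `n` exactly when the block lengths come from positions
`i₁ < ⋯ < iₚ`, and these are then unique; `extend_interleave` turns the evaluation into the sum over
positions. For claim (2), every derivative removes a letter, so `∇ᵖ` kills Wick products with fewer
than `p` letters, and these generate `𝒫ₙ`. -/

/-- The real Hilbert space `L²(ℝ₊; ℝ)`. -/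
abbrev HilbertR : Type := Lp ℝ 2 (volume : Measure ℝ≥0)

/-- The inner product of `L²(ℝ₊; ℝ)` as a complex number. -/
abbrev ipC (h k : HilbertR) : ℂ := inner ℂ (complexify h) (complexify k)

/-- Real-valued functions do not feel the conjugation. This symmetry is behind the reversal of Wick
products under `star` and the trace property. -/
theorem ipC_comm (h k : HilbertR) : ipC h k = ipC k h := by
  rw [ipC, ipC, L2.inner_def, L2.inner_def]
  refine integral_congr_ae ?_
  filter_upwards [Complex.ofRealCLM.coeFn_compLp h, Complex.ofRealCLM.coeFn_compLp k] with x h1 h2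
  have e1 : complexify h x = (h x : ℂ) := h1
  have e2 : complexify k x = (k x : ℂ) := h2
  simp [e1, e2, mul_comm]

theorem star_ipC (h k : HilbertR) : star (ipC h k) = ipC h k :=
  (inner_conj_symm (𝕜 := ℂ) (complexify k) (complexify h)).trans (ipC_comm k h)

/-! ### Wick products over an arbitrary algebra. -/

section Wick

variable {A : Type*} [Ring A] [Algebra ℂ A]

/-- The Wick products `W(h₁, …, hₙ)` of the elements `s(h₁), …, s(hₙ)`, given by
`W(h, k, …) = s(h) W(k, …) - ⟨h, k⟩ W(…)`. -/
def wick (s : HilbertR → A) : List HilbertR → A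
  | [] => 1
  | [h] => s h
  | h :: k :: l => s h * wick s (k :: l) - ipC h k • wick s l

theorem mul_wick_nil (s : HilbertR → A) (h : HilbertR) : s h * wick s [] = wick s [h] := by
  simp [wick]

theorem mul_wick_cons (s : HilbertR → A) (h k : HilbertR) (l : List HilbertR) :
    s h * wick s (k :: l) = wick s (h :: k :: l) + ipC h k • wick s l := by
  simp [wick]

/-- A Wick product is a fixed noncommutative polynomial in the letters, so it can be carried from
the free algebra to `𝒮𝒞_alg`. -/
theorem map_wick {B F : Type*} [Ring B] [Algebra ℂ B] [FunLike F A B] [AlgHomClass F ℂ A B]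
    (f : F) (s : HilbertR → A) (l : List HilbertR) : f (wick s l) = wick (f ∘ s) l := by
  induction l using wick.induct with
  | case1 => simp [wick]
  | case2 h => simp [wick]
  | case3 h k l ih1 ih2 => simp [wick, ih1, ih2]

/-- The recursion for Wick products, from the right. -/
theorem wick_append_pair (s : HilbertR → A) (l : List HilbertR) (k h : HilbertR) :
    wick s (l ++ [k, h]) = wick s (l ++ [k]) * s h - ipC k h • wick s l := by
  induction l using wick.induct with
  | case1 => simp [wick]
  | case2 a =>
    simp only [List.cons_append, List.nil_append, wick, mul_sub, sub_mul, mul_assoc,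
      mul_smul_comm, smul_mul_assoc, one_mul, mul_one]
    abel
  | case3 a b l ih1 ih2 =>
    simp only [List.cons_append] at ih1 ih2 ⊢
    simp only [wick, ih1, ih2, mul_sub, sub_mul, mul_assoc, mul_smul_comm, smul_mul_assoc,
      smul_sub]
    rw [smul_comm (ipC k h)]
    abel

/-- The star turns the recursion from the left into the one from the right, `wick_append_pair`; the
coefficients are real. -/
theorem star_wick [StarRing A] [StarModule ℂ A] (s : HilbertR → A) (hs : ∀ h, star (s h) = s h)
    (l : List HilbertR) : star (wick s l) = wick s l.reverse := by
  induction l using wick.induct with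
  | case1 => simp [wick]
  | case2 h => simp [wick, hs]
  | case3 h k l ih1 ih2 =>
    have h3 : (h :: k :: l).reverse = l.reverse ++ [k, h] := by simp
    rw [h3, wick_append_pair, wick, star_sub, star_mul, star_smul, ih1, ih2, hs, star_ipC,
      ipC_comm h k, List.reverse_cons]

/-- The span of the Wick products of order at most `n`. -/
def wickSpan (s : HilbertR → A) (n : ℕ) : Submodule ℂ A :=
  Submodule.span ℂ (wick s '' {l | l.length ≤ n})

theorem wick_mem_wickSpan (s : HilbertR → A) {l : List HilbertR} {n : ℕ} (h : l.length ≤ n) :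
    wick s l ∈ wickSpan s n :=
  Submodule.subset_span (mem_image_of_mem _ h)

/-- A new letter on the left is either kept or contracted with the first one, so the order rises by
at most one. -/
theorem mul_mem_wickSpan (s : HilbertR → A) (h : HilbertR) {n : ℕ} {a : A}
    (ha : a ∈ wickSpan s n) : s h * a ∈ wickSpan s (n + 1) := by
  induction ha using Submodule.span_induction with
  | mem x hx =>
    obtain ⟨l, hl, rfl⟩ := hx
    have hl' : l.length ≤ n := hl
    cases l with
    | nil => rw [mul_wick_nil]; exact wick_mem_wickSpan s (by simp)
    | cons k l =>
      rw [mul_wick_cons]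
      rw [List.length_cons] at hl'
      refine add_mem (wick_mem_wickSpan s ?_)
        (Submodule.smul_mem _ _ (wick_mem_wickSpan s (by omega)))
      simp only [List.length_cons]
      omega
  | zero => simp
  | add x y _ _ hx hy => rw [mul_add]; exact add_mem hx hy
  | smul c x _ hx => rw [mul_smul_comm]; exact Submodule.smul_mem _ _ hx

theorem wickSpan_mono (s : HilbertR → A) {k n : ℕ} (hk : k ≤ n) : wickSpan s k ≤ wickSpan s n := by
  refine Submodule.span_mono (image_mono ?_)
  intro l hl
  rw [mem_ofPred_eq] at hl ⊢
  exact hl.trans hk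

/-- Passes from the generators of `𝒫ₙ` to Wick products, whose iterated derivatives are computable.
-/
theorem prod_ofFn_mem_wickSpan (s : HilbertR → A) {n k : ℕ} (hk : k ≤ n) (h : Fin k → HilbertR) :
    (List.ofFn fun i => s (h i)).prod ∈ wickSpan s n := by
  refine wickSpan_mono s hk ?_
  clear hk
  induction k with
  | zero =>
    rw [List.ofFn_zero, List.prod_nil]
    exact wick_mem_wickSpan s (l := []) le_rfl
  | succ k ih =>
    rw [List.ofFn_succ, List.prod_cons]
    exact mul_mem_wickSpan s _ (ih _)

/-- The span contains `1` and is stable under left multiplication by each generator, hence by the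
whole algebra. -/
theorem span_wick (s : HilbertR → A) (hs : Algebra.adjoin ℂ (range s) = ⊤) :
    Submodule.span ℂ (range (wick s)) = ⊤ := by
  rw [eq_top_iff]
  suffices H : ∀ x ∈ Algebra.adjoin ℂ (range s), ∀ v ∈ Submodule.span ℂ (range (wick s)),
      x * v ∈ Submodule.span ℂ (range (wick s)) by
    intro x _
    have := H x (by rw [hs]; trivial) 1 (Submodule.subset_span ⟨[], rfl⟩)
    rwa [mul_one] at this
  intro x hx
  induction hx using Algebra.adjoin_induction with
  | mem x hx =>
    obtain ⟨h, rfl⟩ := hx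
    intro v hv
    induction hv using Submodule.span_induction with
    | mem x hx =>
      obtain ⟨l, rfl⟩ := hx
      cases l with
      | nil => rw [mul_wick_nil]; exact Submodule.subset_span ⟨_, rfl⟩
      | cons k l =>
        rw [mul_wick_cons]
        exact add_mem (Submodule.subset_span ⟨_, rfl⟩)
          (Submodule.smul_mem _ _ (Submodule.subset_span ⟨_, rfl⟩))
    | zero => simp
    | add x y _ _ hx hy => rw [mul_add]; exact add_mem hx hy
    | smul c x _ hx => rw [mul_smul_comm]; exact Submodule.smul_mem _ _ hx
  | algebraMap r =>
    intro v hv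
    rw [← Algebra.smul_def]
    exact Submodule.smul_mem _ _ hv
  | add x y _ _ hx hy => intro v hv; rw [add_mul]; exact add_mem (hx v hv) (hy v hv)
  | mul x y _ _ hx hy => intro v hv; rw [mul_assoc]; exact hx _ (hy _ hv)

end Wick

/-! ### Elementary tensors, the trace property, and the separating vacuum. -/

section Vectors

/-- The elementary tensor `h₁ ⊗ ⋯ ⊗ hₙ` in the Fock space. -/
def elemTensor : List HilbertR → Fock
  | [] => vacuum
  | h :: l => creation (complexify h) (elemTensor l)

/-- The inner product of two elementary tensors. -/
def ipList : List HilbertR → List HilbertR → ℂ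
  | [], [] => 1
  | h :: l, k :: m => ipC h k * ipList l m
  | _, _ => 0

theorem semicircular_elemTensor_nil (h : HilbertR) :
    semicircular h (elemTensor []) = elemTensor [h] := by
  rw [semicircular, add_apply, elemTensor, annihilation_vacuum, add_zero, elemTensor, elemTensor]

/-- Creation prepends `h`, annihilation contracts it with `k`: the same two terms as in
`mul_wick_cons`. -/
theorem semicircular_elemTensor_cons (h k : HilbertR) (l : List HilbertR) :
    semicircular h (elemTensor (k :: l)) =
      elemTensor (h :: k :: l) + ipC h k • elemTensor l := by
  rw [semicircular, add_apply, elemTensor, annihilation_creation, elemTensor, elemTensor]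

theorem toVector_field_mul (h : HilbertR) (X : SCalg) :
    toVector (field h * X) = semicircular h (toVector X) := rfl

/-- The term subtracted in the Wick recursion is exactly the annihilation part of `S(h)`, so only
creation survives on the vacuum. -/
theorem toVector_wick (l : List HilbertR) : toVector (wick field l) = elemTensor l := by
  induction l using wick.induct with
  | case1 => rfl
  | case2 h =>
    rw [← mul_wick_nil, toVector_field_mul, ← semicircular_elemTensor_nil]
    rfl
  | case3 h k l ih1 ih2 =>
    rw [wick, map_sub, map_smul, ih2, toVector_field_mul, ih1, semicircular_elemTensor_cons,
      add_sub_cancel_right]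

theorem inner_vacuum : inner ℂ vacuum vacuum = (1 : ℂ) := by
  rw [← wignerIntegral_zero (Lp.const 2 volume 1) (Lp.coeFn_const _ _ _),
    LinearIsometry.inner_map_map, L2.inner_def]
  have : ∀ᵐ s ∂(volume : Measure (Fin 0 → ℝ≥0)), inner ℂ
      ((Lp.const 2 (volume : Measure (Fin 0 → ℝ≥0)) (1 : ℂ)) s)
      ((Lp.const 2 (volume : Measure (Fin 0 → ℝ≥0)) (1 : ℂ)) s) = (1 : ℂ) := by
    filter_upwards [Lp.coeFn_const 2 (volume : Measure (Fin 0 → ℝ≥0)) (1 : ℂ)] with s hs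
    rw [hs]; simp
  rw [integral_congr_ae this, integral_const, volume_pi, Measure.pi_of_empty]
  simp

theorem inner_elemTensor (l m : List HilbertR) :
    inner ℂ (elemTensor l) (elemTensor m) = ipList l m := by
  induction l generalizing m with
  | nil =>
    cases m with
    | nil => exact inner_vacuum
    | cons k m =>
      rw [elemTensor, elemTensor, ← ContinuousLinearMap.adjoint_inner_left, annihilation_vacuum,
        inner_zero_left]
      rfl
  | cons h l ih =>
    cases m with
    | nil =>
      rw [elemTensor, elemTensor, ← ContinuousLinearMap.adjoint_inner_right, annihilation_vacuum,
        inner_zero_right]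
      rfl
    | cons k m => rw [elemTensor, elemTensor, inner_creation, ih]; rfl

theorem ipList_append (l m : List HilbertR) (a b : HilbertR) :
    ipList (l ++ [a]) (m ++ [b]) = ipList l m * ipC a b := by
  induction l generalizing m with
  | nil =>
    cases m with
    | nil => simp [ipList]
    | cons k m => cases m <;> simp [ipList]
  | cons h l ih =>
    cases m with
    | nil => cases l <;> simp [ipList]
    | cons k m => simp only [List.cons_append, ipList, ih, mul_assoc]

theorem ipList_of_length_ne (l m : List HilbertR) (h : l.length ≠ m.length) : ipList l m = 0 := by
  induction l generalizing m with
  | nil =>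
    cases m with
    | nil => exact absurd rfl h
    | cons k m => rfl
  | cons a l ih =>
    cases m with
    | nil => rfl
    | cons k m => rw [ipList, ih m (by simpa using h), mul_zero]

/-- The scalar factors commute, so pairing the letters from the other end changes nothing. Together
with `ipList_comm` this yields the trace property. -/
theorem ipList_reverse (l m : List HilbertR) : ipList l.reverse m.reverse = ipList l m := by
  induction l generalizing m with
  | nil =>
    cases m with
    | nil => rfl
    | cons k m => rw [ipList_of_length_ne _ _ (by simp)]; rfl
  | cons h l ih =>
    cases m with
    | nil => rw [ipList_of_length_ne _ _ (by simp)]; rfl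
    | cons k m =>
      rw [List.reverse_cons, List.reverse_cons, ipList_append, ih, ipList, mul_comm]

theorem ipList_comm (l m : List HilbertR) : ipList l m = ipList m l := by
  induction l generalizing m with
  | nil => cases m <;> rfl
  | cons h l ih =>
    cases m with
    | nil => rfl
    | cons k m => rw [ipList, ipList, ih, ipC_comm]

theorem star_field (h : HilbertR) : star (field h) = field h :=
  Subtype.ext (semicircular_isSelfAdjoint h).star_eq

/-- `⟨X Ω, Y Z Ω⟩ = ⟨Y* X Ω, Z Ω⟩`. -/
theorem inner_toVector_mul (X Y Z : SCalg) :
    inner ℂ (toVector X) (toVector (Y * Z)) = (inner ℂ (toVector (star Y * X)) (toVector Z) : ℂ) := by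
  change inner ℂ _ ((Y : Fock →L[ℂ] Fock) (toVector Z)) =
    inner ℂ ((star Y : Fock →L[ℂ] Fock) (toVector X)) _
  rw [ContinuousLinearMap.star_eq_adjoint, ContinuousLinearMap.adjoint_inner_left]

theorem wick_field_induction {P : SCalg → Prop} (hw : ∀ l, P (wick field l)) (h0 : P 0)
    (hadd : ∀ X Y, P X → P Y → P (X + Y)) (hsmul : ∀ (c : ℂ) X, P X → P (c • X)) (X : SCalg) :
    P X := by
  have hX : X ∈ Submodule.span ℂ (range (wick field)) := by
    rw [span_wick field adjoin_field]; trivial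
  induction hX using Submodule.span_induction with
  | mem x hx => obtain ⟨l, rfl⟩ := hx; exact hw l
  | zero => exact h0
  | add x y _ _ hx hy => exact hadd x y hx hy
  | smul c x _ hx => exact hsmul c x hx

/-- The vacuum state is a trace on `𝒮𝒞_alg`. -/
theorem inner_vacuum_mul_comm (X Y : SCalg) :
    inner ℂ vacuum (toVector (X * Y)) = (inner ℂ vacuum (toVector (Y * X)) : ℂ) := by
  induction X using wick_field_induction with
  | hw l =>
    induction Y using wick_field_induction with
    | hw m =>
      -- Moving the first factor to the left slot reverses its word. The right-hand side is then
      -- symmetric in the two words, up to reversing both.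
      have key : ∀ l m, inner ℂ vacuum (toVector (wick field l * wick field m)) =
          ipList l.reverse m := fun l m => by
        have : vacuum = toVector 1 := rfl
        rw [this, inner_toVector_mul, mul_one, star_wick _ star_field, toVector_wick,
          toVector_wick, inner_elemTensor]
      rw [key, key, ← ipList_reverse, List.reverse_reverse, ipList_comm]
    | h0 => simp
    | hadd X Y hX hY => rw [mul_add, add_mul, map_add, map_add, inner_add_right, inner_add_right, hX, hY]
    | hsmul c X hX =>
      rw [mul_smul_comm, smul_mul_assoc, map_smul, map_smul, inner_smul_right, inner_smul_right, hX]
  | h0 => simp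
  | hadd X Y hX hY => rw [mul_add, add_mul, map_add, map_add, inner_add_right, inner_add_right, hX, hY]
  | hsmul c X hX =>
    rw [mul_smul_comm, smul_mul_assoc, map_smul, map_smul, inner_smul_right, inner_smul_right, hX]

/-- The vacuum vector is separating for `𝒮𝒞_alg`. -/
theorem toVector_injective : Function.Injective toVector := by
  rw [injective_iff_map_eq_zero]
  intro X hX
  -- By traciality `‖X Y Ω‖² = τ(Y* X* X Y) = τ(Y Y* X* X)`, and the last expression contains `X Ω =
  -- 0`. Density of the vectors `Y Ω` then forces `X = 0`.
  have h1 : ∀ Y, toVector (X * Y) = 0 := by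
    intro Y
    have hv : vacuum = toVector 1 := rfl
    have e1 := inner_toVector_mul 1 (star (X * Y)) (X * Y)
    rw [star_star, mul_one] at e1
    rw [← inner_self_eq_zero (𝕜 := ℂ), ← e1, ← hv]
    have e2 : star (X * Y) * (X * Y) = (star Y * star X * X) * Y := by
      rw [star_mul, mul_assoc, mul_assoc, mul_assoc]
    have e3 : Y * (star Y * star X * X) = (Y * star Y * star X) * X := by simp only [mul_assoc]
    rw [e2, inner_vacuum_mul_comm, e3, hv, inner_toVector_mul, hX, inner_zero_right]
  refine Subtype.ext (ContinuousLinearMap.ext fun φ => ?_)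
  exact toVector_denseRange.induction_on (p := fun φ => (X : Fock →L[ℂ] Fock) φ = (0 : Fock →L[ℂ] Fock) φ)
    φ (isClosed_eq (X : Fock →L[ℂ] Fock).continuous continuous_const) fun Y => h1 Y

/-- An element of `𝒮𝒞_alg` which is orthogonal to all elementary tensors vanishes. -/
theorem eq_zero_of_inner_elemTensor {X : SCalg}
    (h : ∀ l, inner ℂ (elemTensor l) (toVector X) = (0 : ℂ)) : X = 0 := by
  apply toVector_injective
  rw [map_zero, ← inner_self_eq_zero (𝕜 := ℂ)]
  suffices H : ∀ Y : SCalg, inner ℂ (toVector Y) (toVector X) = (0 : ℂ) from H X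
  intro Y
  induction Y using wick_field_induction with
  | hw l => rw [toVector_wick, h]
  | h0 => simp
  | hadd X Y hX hY => rw [map_add, inner_add_left, hX, hY, add_zero]
  | hsmul c X hX => rw [map_smul, inner_smul_left, hX, mul_zero]

end Vectors

end WignerSpace

end

noncomputable section

namespace WignerSpace

/-! ### Separating points of algebraic tensor products. -/

section TensorDual

variable {𝕜 M N : Type*} [Field 𝕜] [AddCommGroup M] [Module 𝕜 M] [AddCommGroup N] [Module 𝕜 N]

/-- The linear functional `f ⊗ g` on `M ⊗ N`. -/
def pairDual (f : M →ₗ[𝕜] 𝕜) (g : N →ₗ[𝕜] 𝕜) : M ⊗[𝕜] N →ₗ[𝕜] 𝕜 :=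
  (TensorProduct.lid 𝕜 𝕜).toLinearMap ∘ₗ TensorProduct.map f g

@[simp] theorem pairDual_tmul (f : M →ₗ[𝕜] 𝕜) (g : N →ₗ[𝕜] 𝕜) (m : M) (n : N) :
    pairDual f g (m ⊗ₜ n) = f m * g n := by
  simp [pairDual]

/-- If two families of functionals separate points, so do their tensor products. -/
theorem eq_zero_of_pairDual {ι κ : Type*} {f : ι → M →ₗ[𝕜] 𝕜} {g : κ → N →ₗ[𝕜] 𝕜}
    (hf : ∀ m, (∀ i, f i m = 0) → m = 0) (hg : ∀ n, (∀ j, g j n = 0) → n = 0) {u : M ⊗[𝕜] N}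
    (hu : ∀ i j, pairDual (f i) (g j) u = 0) : u = 0 := by
  -- Slicing the second factor by `g j` leaves an element of `M` that every `f i` kills.
  have h1 (j) : TensorProduct.rid 𝕜 M (LinearMap.lTensor M (g j) u) = 0 := by
    refine hf _ fun i => ?_
    have e : f i ∘ₗ (TensorProduct.rid 𝕜 M).toLinearMap ∘ₗ LinearMap.lTensor M (g j) =
        pairDual (f i) (g j) := by
      ext m n
      simp [mul_comm]
    exact (LinearMap.congr_fun e u).trans (hu i j)
  classical
  -- Relative to a basis of `M`, `u` is a finite family in `N`; `g j` of a member of this family is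
  -- a coordinate of the slice by `g j`, hence zero.
  let b := Module.Basis.ofVectorSpace 𝕜 M
  refine (TensorProduct.equivFinsuppOfBasisLeft (N := N) b).map_eq_zero_iff.1 ?_
  refine Finsupp.ext fun i => hg _ fun j => ?_
  have e : g j ∘ₗ Finsupp.lapply i ∘ₗ (TensorProduct.equivFinsuppOfBasisLeft (N := N) b).toLinearMap =
      b.coord i ∘ₗ (TensorProduct.rid 𝕜 M).toLinearMap ∘ₗ LinearMap.lTensor M (g j) := by
    ext m n
    simp [mul_comm]
  refine (LinearMap.congr_fun e u).trans ?_
  change b.coord i (TensorProduct.rid 𝕜 M (LinearMap.lTensor M (g j) u)) = 0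
  rw [h1, map_zero]

end TensorDual

/-! ### Cutting a word at one of its letters. -/

section Splits

/-- The decompositions of a list `l` as `a ++ h :: b`. -/
def splits {α : Type*} : List α → List (List α × α × List α)
  | [] => []
  | h :: l => ([], h, l) :: (splits l).map fun x => (h :: x.1, x.2)

theorem length_of_mem_splits {α : Type*} {l : List α} {x : List α × α × List α}
    (hx : x ∈ splits l) : x.2.2.length < l.length := by
  induction l generalizing x with
  | nil => simp [splits] at hx
  | cons h l ih =>
    rw [splits, List.mem_cons, List.mem_map] at hx
    rcases hx with rfl | ⟨y, hy, rfl⟩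
    · simp
    · exact (ih hy).trans (by simp)

/-- Cutting is dual to concatenating: only the cut whose left piece is as long as `l` can
contribute, and it recombines to the full pairing. -/
theorem sum_splits_ipList (l m n : List HilbertR) (k : HilbertR) :
    ((splits n).map fun x => ipC k x.2.1 * (ipList l x.1 * ipList m x.2.2)).sum =
      ipList (l ++ k :: m) n := by
  induction n generalizing l with
  | nil => cases l <;> rfl
  | cons h n ih =>
    cases l with
    | nil =>
      simp only [splits, List.map_cons, List.map_map, List.sum_cons, List.nil_append]
      rw [List.sum_eq_zero]
      · simp [ipList]
      · simp only [List.mem_map, Function.comp_apply]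
        rintro _ ⟨x, -, rfl⟩
        simp [ipList]
    | cons a l =>
      simp only [splits, List.map_cons, List.map_map, List.sum_cons, List.cons_append]
      rw [ipList, ← ih l, ← List.sum_map_mul_left]
      simp only [ipList, Function.comp_def, zero_mul, mul_zero, zero_add]
      congr 2
      funext x
      ring

end Splits

/-! ### The derivation on the free algebra and its descent to the quotient. -/

section Derivation

variable {H A : Type*} [AddCommGroup H] [Module ℂ H] [Ring A] [Algebra ℂ A]

/-- Multiplication of the first `A`-leg from the left. -/
def leftMul (X : A) : H ⊗[ℂ] (A ⊗[ℂ] A) →ₗ[ℂ] H ⊗[ℂ] (A ⊗[ℂ] A) :=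
  LinearMap.lTensor H (LinearMap.rTensor A (LinearMap.mulLeft ℂ X))

/-- Multiplication of the second `A`-leg from the right. -/
def rightMul (X : A) : H ⊗[ℂ] (A ⊗[ℂ] A) →ₗ[ℂ] H ⊗[ℂ] (A ⊗[ℂ] A) :=
  LinearMap.lTensor H (LinearMap.lTensor A (LinearMap.mulRight ℂ X))

@[simp] theorem leftMul_tmul (X : A) (h : H) (a b : A) :
    leftMul X (h ⊗ₜ (a ⊗ₜ b)) = h ⊗ₜ ((X * a) ⊗ₜ b) := rfl

@[simp] theorem rightMul_tmul (X : A) (h : H) (a b : A) :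
    rightMul X (h ⊗ₜ (a ⊗ₜ b)) = h ⊗ₜ (a ⊗ₜ (b * X)) := rfl

theorem tensor_triple_ext {P : Type*} [AddCommGroup P] [Module ℂ P]
    {f g : H ⊗[ℂ] (A ⊗[ℂ] A) →ₗ[ℂ] P}
    (h : ∀ x a b, f (x ⊗ₜ (a ⊗ₜ b)) = g (x ⊗ₜ (a ⊗ₜ b))) : f = g := by
  ext x a b
  exact h x a b

theorem leftMul_mul (X Y : A) (u : H ⊗[ℂ] (A ⊗[ℂ] A)) : leftMul (X * Y) u = leftMul X (leftMul Y u) :=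
  LinearMap.congr_fun (tensor_triple_ext (g := leftMul X ∘ₗ leftMul Y)
    fun x a b => by simp [mul_assoc]) u

theorem rightMul_mul (X Y : A) (u : H ⊗[ℂ] (A ⊗[ℂ] A)) :
    rightMul (X * Y) u = rightMul Y (rightMul X u) :=
  LinearMap.congr_fun (tensor_triple_ext (g := rightMul Y ∘ₗ rightMul X)
    fun x a b => by simp [mul_assoc]) u

theorem leftMul_rightMul (X Y : A) (u : H ⊗[ℂ] (A ⊗[ℂ] A)) :
    leftMul X (rightMul Y u) = rightMul Y (leftMul X u) :=
  LinearMap.congr_fun (tensor_triple_ext (f := leftMul X ∘ₗ rightMul Y)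
    (g := rightMul Y ∘ₗ leftMul X) fun x a b => by simp) u

theorem rightMul_one (u : H ⊗[ℂ] (A ⊗[ℂ] A)) : rightMul 1 u = u :=
  LinearMap.congr_fun (tensor_triple_ext (g := LinearMap.id) fun x a b => by simp) u

theorem leftMul_add (X Y : A) (u : H ⊗[ℂ] (A ⊗[ℂ] A)) :
    leftMul (X + Y) u = leftMul X u + leftMul Y u :=
  LinearMap.congr_fun (tensor_triple_ext (g := leftMul X + leftMul Y)
    fun x a b => by simp [add_mul, add_tmul, tmul_add]) u

theorem leftMul_smul_one (c : ℂ) (u : H ⊗[ℂ] (A ⊗[ℂ] A)) : leftMul (c • 1) u = c • u :=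
  LinearMap.congr_fun (tensor_triple_ext (g := c • LinearMap.id)
    fun x a b => by simp [← smul_tmul']) u

variable (s : HilbertR → A) (c : HilbertR → H)

/-- The value of the derivative on a Wick product. -/
theorem derivation_wick {B : Type*} [Ring B] [Algebra ℂ B] (s' : HilbertR → B) (π : B →ₐ[ℂ] A)
    (hπ : ∀ h, π (s' h) = s h) (D : B →ₗ[ℂ] H ⊗[ℂ] (A ⊗[ℂ] A))
    (hs : ∀ h, D (s' h) = c h ⊗ₜ[ℂ] ((1 : A) ⊗ₜ[ℂ] (1 : A)))
    (hD : ∀ x y, D (x * y) = leftMul (π x) (D y) + rightMul (π y) (D x)) (l : List HilbertR) :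
    D (wick s' l) = ((splits l).map fun x =>
      c x.2.1 ⊗ₜ[ℂ] (wick s x.1 ⊗ₜ[ℂ] wick s x.2.2)).sum := by
  -- The map `π` lets one argument serve twice: for the free algebra mapping onto `A`, and for
  -- `𝒮𝒞_alg` itself with `π` the identity.
  have hw : ∀ l, π (wick s' l) = wick s l := fun l => by
    rw [map_wick, show π ∘ s' = s from funext hπ]
  have h1 : D 1 = 0 := by
    have h3 := hD 1 1
    have h2 : leftMul 1 (D 1) = D 1 := by simpa using leftMul_smul_one 1 (D 1)
    rw [mul_one, _root_.map_one π, rightMul_one, h2] at h3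
    exact left_eq_add.1 h3
  induction l using wick.induct with
  | case1 => simpa [splits, wick] using h1
  | case2 h => simp [splits, wick, hs]
  | case3 h k l ih1 ih2 =>
    rw [wick, map_sub, map_smul, hD, ih1, ih2, hπ, hw, hs]
    simp only [splits, List.map_cons, List.map_map, List.sum_cons, map_add, leftMul_tmul,
      rightMul_tmul, one_mul, Function.comp_def]
    -- Left multiplication only meets the first leg, a word beginning with `k`. The contraction it
    -- produces is summed over the cuts of `l` and cancels the derivative of the subtracted Wick
    -- term.
    have key : ∀ L : List (List HilbertR × HilbertR × List HilbertR),
        leftMul (s h) ((L.map fun x => c x.2.1 ⊗ₜ[ℂ]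
          (wick s (k :: x.1) ⊗ₜ[ℂ] wick s x.2.2)).sum) =
        (L.map fun x => c x.2.1 ⊗ₜ[ℂ]
          (wick s (h :: k :: x.1) ⊗ₜ[ℂ] wick s x.2.2)).sum +
        ipC h k • (L.map fun x => c x.2.1 ⊗ₜ[ℂ]
          (wick s x.1 ⊗ₜ[ℂ] wick s x.2.2)).sum := by
      intro L
      induction L with
      | nil => simp
      | cons x L ih =>
        simp only [List.map_cons, List.sum_cons, map_add, ih, leftMul_tmul, mul_wick_cons,
          add_tmul, tmul_add, smul_add, ← smul_tmul', tmul_smul]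
        abel
    rw [key]
    simp only [wick, mul_one]
    abel

/-- The representation of the free algebra on `A ⊕ (H ⊙ A ⊙ A)` which encodes the derivation. -/
def triangularRep : FreeAlgebra ℂ HilbertR →ₐ[ℂ] Module.End ℂ (A × H ⊗[ℂ] (A ⊗[ℂ] A)) :=
  FreeAlgebra.lift ℂ fun h =>
    (LinearMap.mulLeft ℂ (s h) ∘ₗ LinearMap.fst ℂ A (H ⊗[ℂ] (A ⊗[ℂ] A))).prod
      (leftMul (s h) ∘ₗ LinearMap.snd ℂ A (H ⊗[ℂ] (A ⊗[ℂ] A)) +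
        TensorProduct.mk ℂ H (A ⊗[ℂ] A) (c h) ∘ₗ
          TensorProduct.mk ℂ A A 1 ∘ₗ LinearMap.fst ℂ A (H ⊗[ℂ] (A ⊗[ℂ] A)))

/-- The free difference quotient on noncommutative polynomials. -/
def freeDeriv : FreeAlgebra ℂ HilbertR →ₗ[ℂ] H ⊗[ℂ] (A ⊗[ℂ] A) :=
  LinearMap.snd ℂ A (H ⊗[ℂ] (A ⊗[ℂ] A)) ∘ₗ
    LinearMap.applyₗ ((1, 0) : A × H ⊗[ℂ] (A ⊗[ℂ] A)) ∘ₗ (triangularRep s c).toLinearMap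

theorem freeDeriv_apply (x : FreeAlgebra ℂ HilbertR) :
    freeDeriv s c x = (triangularRep s c x (1, 0)).2 := rfl

/-- In a triangular representation the corner entry of a product obeys the Leibniz rule. General
`(a, m)` is needed because in a product the left factor acts on the output of the right one. -/
theorem triangularRep_apply (x : FreeAlgebra ℂ HilbertR) (a : A) (m : H ⊗[ℂ] (A ⊗[ℂ] A)) :
    triangularRep s c x (a, m) = (FreeAlgebra.lift ℂ s x * a,
      leftMul (FreeAlgebra.lift ℂ s x) m + rightMul a (freeDeriv s c x)) := by
  induction x using FreeAlgebra.induction generalizing a m with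
  | grade0 r =>
    rw [freeDeriv_apply, AlgHom.commutes, AlgHom.commutes, Algebra.algebraMap_eq_smul_one,
      Algebra.algebraMap_eq_smul_one]
    refine Prod.ext ?_ ?_
    · simp
    · simp [leftMul_smul_one]
  | grade1 h =>
    rw [freeDeriv_apply, triangularRep, FreeAlgebra.lift_ι_apply, FreeAlgebra.lift_ι_apply]
    refine Prod.ext ?_ ?_
    · simp
    · simp
  | mul x y hx hy =>
    rw [freeDeriv_apply, map_mul, map_mul, Module.End.mul_apply, Module.End.mul_apply, hy, hx, hy,
      hx]
    refine Prod.ext ?_ ?_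
    · simp [mul_assoc]
    · simp only [map_add, map_zero, zero_add, mul_one, rightMul_one, leftMul_mul,
        leftMul_rightMul, rightMul_mul, add_assoc]
  | add x y hx hy =>
    rw [map_add, map_add, map_add, LinearMap.add_apply, hx, hy]
    refine Prod.ext ?_ ?_
    · simp [add_mul]
    · simp only [leftMul_add, map_add, Prod.snd_add]
      abel

theorem freeDeriv_mul (x y : FreeAlgebra ℂ HilbertR) : freeDeriv s c (x * y) =
    leftMul (FreeAlgebra.lift ℂ s x) (freeDeriv s c y) +
      rightMul (FreeAlgebra.lift ℂ s y) (freeDeriv s c x) := by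
  rw [freeDeriv_apply, map_mul, Module.End.mul_apply, triangularRep_apply s c y,
    triangularRep_apply s c x]
  simp [rightMul_one]

theorem freeDeriv_ι (h : HilbertR) : freeDeriv s c (FreeAlgebra.ι ℂ h) =
    c h ⊗ₜ[ℂ] ((1 : A) ⊗ₜ[ℂ] (1 : A)) := by
  rw [freeDeriv_apply, triangularRep, FreeAlgebra.lift_ι_apply]
  simp

variable {s c}
variable {ψ : HilbertR → H →ₗ[ℂ] ℂ} (hψ : ∀ k h, ψ k (c h) = ipC k h)
  {φ : List HilbertR → A →ₗ[ℂ] ℂ} (hφ : ∀ l m, φ l (wick s m) = ipList l m)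

-- Tested on Wick words, which span the free algebra, this is `sum_splits_ipList`. The right-hand
-- side sees `x` only through its image in `A`, which is why the derivation respects the relations
-- of `A`.
include hψ hφ in
theorem pairDual_freeDeriv (k : HilbertR) (l m : List HilbertR) (x : FreeAlgebra ℂ HilbertR) :
    pairDual (ψ k) (pairDual (φ l) (φ m)) (freeDeriv s c x) =
      φ (l ++ k :: m) (FreeAlgebra.lift ℂ s x) := by
  refine LinearMap.congr_fun (f := pairDual (ψ k) (pairDual (φ l) (φ m)) ∘ₗ freeDeriv s c)
    (g := φ (l ++ k :: m) ∘ₗ (FreeAlgebra.lift ℂ s).toLinearMap) ?_ x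
  refine LinearMap.ext_on_range (v := wick (FreeAlgebra.ι ℂ))
    (span_wick _ (FreeAlgebra.adjoin_range_ι ..)) fun n => ?_
  have hs : ∀ h, FreeAlgebra.lift ℂ s (FreeAlgebra.ι ℂ h) = s h := fun h => by simp
  rw [LinearMap.comp_apply, LinearMap.comp_apply, derivation_wick s c _ (FreeAlgebra.lift ℂ s) hs
    (freeDeriv s c) (freeDeriv_ι s c) (freeDeriv_mul s c), map_list_sum, AlgHom.toLinearMap_apply,
    map_wick, show FreeAlgebra.lift ℂ s ∘ FreeAlgebra.ι ℂ = s from funext hs, hφ,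
    ← sum_splits_ipList, List.map_map]
  congr 2
  funext y
  simp only [Function.comp_apply, pairDual_tmul, hφ, hψ]

include hψ hφ in
/-- Existence of the derivation with `s(h) ↦ c(h) ⊗ 1 ⊗ 1`, provided that the dual families `ψ`
and `φ` separate points. -/
theorem exists_derivation (hs : Algebra.adjoin ℂ (range s) = ⊤)
    (hψ0 : ∀ m, (∀ k, ψ k m = 0) → m = 0) (hφ0 : ∀ a, (∀ l, φ l a = 0) → a = 0) :
    ∃ D : A →ₗ[ℂ] H ⊗[ℂ] (A ⊗[ℂ] A),
      (∀ h, D (s h) = c h ⊗ₜ[ℂ] ((1 : A) ⊗ₜ[ℂ] (1 : A))) ∧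
      ∀ a b, D (a * b) = leftMul a (D b) + rightMul b (D a) := by
  have hsurj : Function.Surjective (FreeAlgebra.lift ℂ s) := by
    rw [← AlgHom.range_eq_top, eq_top_iff, ← hs]
    refine Algebra.adjoin_le ?_
    rintro _ ⟨h, rfl⟩
    exact ⟨FreeAlgebra.ι ℂ h, by simp⟩
  -- All coefficients of the derivative are coefficients of the image of `x`, which is zero;
  -- separation is used once for `H` and once more inside `A ⊗ A`.
  have hker (x) (hx : FreeAlgebra.lift ℂ s x = 0) : freeDeriv s c x = 0 := by
    refine eq_zero_of_pairDual (κ := List HilbertR × List HilbertR) (f := ψ)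
      (g := fun y => pairDual (φ y.1) (φ y.2)) hψ0 (fun n hn => ?_) fun k y => ?_
    · exact eq_zero_of_pairDual hφ0 hφ0 fun l m => hn (l, m)
    · rw [pairDual_freeDeriv hψ hφ, hx, map_zero]
  -- A linear choice of polynomial representatives; by `hker` the derivative does not depend on the
  -- choice.
  obtain ⟨σ, hσ⟩ := (FreeAlgebra.lift ℂ s).toLinearMap.exists_rightInverse_of_surjective
    (LinearMap.range_eq_top.2 hsurj)
  have h1 (X : A) : FreeAlgebra.lift ℂ s (σ X) = X := LinearMap.congr_fun hσ X
  have h2 (x) : freeDeriv s c (σ (FreeAlgebra.lift ℂ s x)) = freeDeriv s c x := by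
    rw [← sub_eq_zero, ← map_sub]
    exact hker _ (by rw [map_sub, h1, sub_self])
  refine ⟨freeDeriv s c ∘ₗ σ, fun h => ?_, fun X Y => ?_⟩
  · have h3 : s h = FreeAlgebra.lift ℂ s (FreeAlgebra.ι ℂ h) := by simp
    rw [h3, LinearMap.comp_apply, h2, freeDeriv_ι]
  · rw [LinearMap.comp_apply]
    nth_rewrite 1 [← h1 X, ← h1 Y]
    rw [← map_mul, h2, freeDeriv_mul, h1, h1]
    rfl

end Derivation

/-! ### Existence of the free Malliavin derivative. -/

section Gradient

/-- Real functions suffice as test vectors, since `m` is the complex combination of its real and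
imaginary parts. -/
theorem eq_zero_of_inner_complexify {m : HilbertC}
    (h : ∀ k, inner ℂ (complexify k) m = (0 : ℂ)) : m = 0 := by
  have h1 : m = complexify (Complex.reCLM.compLp m) +
      Complex.I • complexify (Complex.imCLM.compLp m) := by
    refine Lp.ext ?_
    filter_upwards [Lp.coeFn_add (complexify (Complex.reCLM.compLp m))
        (Complex.I • complexify (Complex.imCLM.compLp m)),
      Lp.coeFn_smul Complex.I (complexify (Complex.imCLM.compLp m)),
      Complex.ofRealCLM.coeFn_compLp (Complex.reCLM.compLp m),
      Complex.ofRealCLM.coeFn_compLp (Complex.imCLM.compLp m),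
      Complex.reCLM.coeFn_compLp m, Complex.imCLM.coeFn_compLp m] with x e1 e2 e3 e4 e5 e6
    rw [e1, Pi.add_apply, e2, Pi.smul_apply, complexify, complexify, e3, e4, e5, e6]
    simp only [Complex.ofRealCLM_apply, Complex.reCLM_apply, Complex.imCLM_apply, smul_eq_mul]
    rw [mul_comm, Complex.re_add_im]
  rw [← inner_self_eq_zero (𝕜 := ℂ)]
  nth_rewrite 1 [h1]
  rw [inner_add_left, inner_smul_left, h, h, mul_zero, add_zero]

/-- The functional `X ↦ ⟨h₁ ⊗ ⋯ ⊗ hₙ, X Ω⟩`. -/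
def coeffFunctional (l : List HilbertR) : SCalg →ₗ[ℂ] ℂ :=
  (innerSL ℂ (elemTensor l)).toLinearMap ∘ₗ toVector

theorem coeffFunctional_wick (l m : List HilbertR) :
    coeffFunctional l (wick field m) = ipList l m := by
  change inner ℂ (elemTensor l) (toVector (wick field m)) = _
  rw [toVector_wick, inner_elemTensor]

/-- `gradient` is a choice with default value `0`, so its properties hold only once some derivation
is exhibited. -/
theorem isMalliavinDerivation_gradient : IsMalliavinDerivation gradient := by
  have h : ∃ D, IsMalliavinDerivation D := by
    obtain ⟨D, h1, h2⟩ := exists_derivation (s := field) (c := complexify)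
      (ψ := fun k => (innerSL ℂ (complexify k)).toLinearMap) (fun _ _ => rfl)
      (φ := coeffFunctional) coeffFunctional_wick adjoin_field
      (fun _ hm => eq_zero_of_inner_complexify hm) fun _ hX => eq_zero_of_inner_elemTensor hX
    exact ⟨D, h1, h2⟩
  rw [gradient, dif_pos h]
  exact h.choose_spec

/-- In the Wick basis the derivative is pure deconcatenation. -/
theorem gradient_wick (l : List HilbertR) : gradient (wick field l) = ((splits l).map fun x =>
    complexify x.2.1 ⊗ₜ[ℂ] (wick field x.1 ⊗ₜ[ℂ] wick field x.2.2)).sum :=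
  derivation_wick field complexify field (AlgHom.id ℂ SCalg) (fun _ => rfl) gradient
    isMalliavinDerivation_gradient.map_field isMalliavinDerivation_gradient.leibniz l

end Gradient

end WignerSpace

end

noncomputable section

namespace WignerSpace

/-! ### Integration over concatenated sequences. -/

section Concatenation

/-- Concatenation of finite sequences. -/
def confAppend (z : Conf × Conf) : Conf := ⟨z.1.1 + z.2.1, Fin.append z.1.2 z.2.2⟩

theorem measurable_of_conf_prod {Z : Type*} [MeasurableSpace Z] {f : Conf × Conf → Z}
    (hf : ∀ m k, Measurable fun z : (Fin m → ℝ≥0) × (Fin k → ℝ≥0) =>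
      f (toConf m z.1, toConf k z.2)) : Measurable f := by
  intro s hs
  have h : f ⁻¹' s = ⋃ q : ℕ × ℕ, Prod.map (toConf q.1) (toConf q.2) ''
      ((fun z => f (toConf q.1 z.1, toConf q.2 z.2)) ⁻¹' s) := by
    ext ⟨⟨m, x⟩, ⟨k, y⟩⟩
    simp only [mem_preimage, mem_iUnion, mem_image]
    constructor
    · exact fun h => ⟨(m, k), (x, y), h, rfl⟩
    · rintro ⟨q, z, hz, h⟩
      rw [← h]; exact hz
  rw [h]
  exact MeasurableSet.iUnion fun q => ((measurableEmbedding_mk q.1).prodMap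
    (measurableEmbedding_mk q.2)).measurableSet_image.2 (hf q.1 q.2 hs)

theorem measurePreserving_append (m k : ℕ) :
    MeasurePreserving (fun z : (Fin m → ℝ≥0) × (Fin k → ℝ≥0) => Fin.append z.1 z.2) := by
  have h := (volume_measurePreserving_piCongrLeft (fun _ : Fin (m + k) => ℝ≥0)
    finSumFinEquiv).comp
    (volume_measurePreserving_sumPiEquivProdPi_symm (fun _ : Fin m ⊕ Fin k => ℝ≥0))
  suffices e : (fun z : (Fin m → ℝ≥0) × (Fin k → ℝ≥0) => Fin.append z.1 z.2) =
      ⇑(MeasurableEquiv.piCongrLeft (fun _ : Fin (m + k) => ℝ≥0) finSumFinEquiv) ∘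
      ⇑(MeasurableEquiv.sumPiEquivProdPi fun _ : Fin m ⊕ Fin k => ℝ≥0).symm by
    rw [e]
    exact h
  funext z i
  rw [Function.comp_apply, MeasurableEquiv.coe_piCongrLeft]
  obtain ⟨j, rfl⟩ := finSumFinEquiv.surjective i
  rw [Equiv.piCongrLeft_apply_apply]
  cases j with
  | inl j => rw [finSumFinEquiv_apply_left, Fin.append_left]; rfl
  | inr j => rw [finSumFinEquiv_apply_right, Fin.append_right]; rfl

@[fun_prop]
theorem measurable_confAppend : Measurable confAppend :=
  measurable_of_conf_prod fun m k =>
    (measurableEmbedding_mk (m + k)).measurable.comp (measurePreserving_append m k).measurable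

theorem lintegral_conf {F : Conf → ℝ≥0∞} :
    ∫⁻ c, F c ∂confMeasure = ∑' n, ∫⁻ s : Fin n → ℝ≥0, F (toConf n s) := by
  rw [confMeasure, lintegral_sum_measure]
  exact tsum_congr fun n => (measurableEmbedding_mk n).lintegral_map _

theorem lintegral_consConf {F : Conf → ℝ≥0∞} (hF : Measurable F) :
    ∫⁻ t : ℝ≥0, ∫⁻ d, F (consConf (t, d)) ∂confMeasure =
      ∑' k, ∫⁻ s : Fin (k + 1) → ℝ≥0, F (toConf (k + 1) s) := by
  rw [← lintegral_prod (fun z => F (consConf z))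
      (hF.comp measurableEmbedding_consConf.measurable).aemeasurable,
    ← measurableEmbedding_consConf.lintegral_map F, consConf_map,
    ← lintegral_indicator measurableEmbedding_consConf.measurableSet_range, lintegral_conf,
    tsum_eq_zero_add' ENNReal.summable]
  have h0 : ∀ s, toConf 0 s ∉ range consConf := by
    rintro s ⟨y, hy⟩
    exact absurd (congrArg Sigma.fst hy) (Nat.succ_ne_zero _)
  have h1 : ∀ k s, toConf (k + 1) s ∈ range consConf := fun k s =>
    ⟨(s 0, ⟨k, Fin.tail s⟩), by simp [consConf, toConf]⟩
  simp only [indicator_of_notMem (h0 _), indicator_of_mem (h1 _ _), lintegral_zero, zero_add]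

/-- Each point of `ℝ₊ⁿ` can be cut at `n` of its coordinates. -/
theorem lintegral_cut {F : Conf → ℝ≥0∞} (hF : Measurable F) :
    ∫⁻ c, ∫⁻ t : ℝ≥0, ∫⁻ d, F (confAppend (c, consConf (t, d))) ∂confMeasure ∂volume ∂confMeasure =
      ∫⁻ c, c.1 * F c ∂confMeasure := by
  have h1 (m k : ℕ) : ∫⁻ s : Fin m → ℝ≥0, ∫⁻ s' : Fin k → ℝ≥0,
      F (confAppend (toConf m s, toConf k s')) =
      ∫⁻ s : Fin (m + k) → ℝ≥0, F (toConf (m + k) s) := by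
    have hm : Measurable fun s : Fin (m + k) → ℝ≥0 => F (toConf (m + k) s) :=
      hF.comp (measurableEmbedding_mk _).measurable
    rw [← (measurePreserving_append m k).lintegral_comp hm]
    exact (lintegral_prod _
      (hm.comp (measurePreserving_append m k).measurable).aemeasurable).symm
  have h2 (c : Conf) : Measurable fun d => F (confAppend (c, d)) :=
    hF.comp (measurable_confAppend.comp measurable_prodMk_left)
  calc _ = ∫⁻ c, ∑' k, ∫⁻ s : Fin (k + 1) → ℝ≥0, F (confAppend (c, toConf (k + 1) s))
        ∂volume ∂confMeasure := lintegral_congr fun c => lintegral_consConf (h2 c)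
    _ = ∑' m, ∑' k, ∫⁻ s : Fin (m + (k + 1)) → ℝ≥0, F (toConf (m + (k + 1)) s) := by
      rw [lintegral_conf]
      refine tsum_congr fun m => ?_
      rw [lintegral_tsum fun k => ?_]
      · exact tsum_congr fun k => h1 m (k + 1)
      · refine Measurable.aemeasurable (Measurable.lintegral_prod_right'
          (f := fun z : (Fin m → ℝ≥0) × (Fin (k + 1) → ℝ≥0) =>
            F (confAppend (toConf m z.1, toConf (k + 1) z.2))) ?_)
        exact (hF.comp (measurableEmbedding_mk _).measurable).comp
          (measurePreserving_append m (k + 1)).measurable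
    _ = ∑' n, n * ∫⁻ s : Fin n → ℝ≥0, F (toConf n s) := by
      set g : ℕ → ℝ≥0∞ := fun n => ∫⁻ s : Fin n → ℝ≥0, F (toConf n s)
      -- Regroup by total length `n + 1`: there are `n + 1` pairs with `m + k = n`, all giving the
      -- same integral. Length `0` carries weight `0`, so the shift loses nothing.
      rw [← ENNReal.tsum_prod (f := fun m k => g (m + (k + 1))),
        ← Finset.HasAntidiagonal.sigmaAntidiagonalEquivProd.tsum_eq (fun q : ℕ × ℕ => g (q.1 + (q.2 + 1))),
        ENNReal.tsum_sigma',
        tsum_eq_zero_add' (f := fun n : ℕ => n * g n) ENNReal.summable]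
      rw [Nat.cast_zero, zero_mul, zero_add]
      refine tsum_congr fun n => ?_
      rw [tsum_fintype, Finset.sum_congr rfl (g := fun _ => g (n + 1))]
      · simp
      · rintro ⟨q, hq⟩ -
        change g (q.1 + (q.2 + 1)) = g (n + 1)
        rw [← add_assoc, Finset.HasAntidiagonal.mem_antidiagonal.1 hq]
    _ = ∫⁻ c, c.1 * F c ∂confMeasure := by
      rw [lintegral_conf]
      refine tsum_congr fun n => ?_
      exact (lintegral_const_mul _ (hF.comp (measurableEmbedding_mk n).measurable)).symm

/-- The concatenation `c₀ t₁ c₁ ⋯ tₚ cₚ`. -/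
def interleave : (p : ℕ) → (Fin p → ℝ≥0) → (Fin (p + 1) → Conf) → Conf
  | 0, _, c => c 0
  | p + 1, t, c => confAppend (c 0, consConf (t 0, interleave p (Fin.tail t) (Fin.tail c)))

@[fun_prop]
theorem measurable_consConf : Measurable consConf := measurableEmbedding_consConf.measurable

@[fun_prop]
theorem measurable_tail {Y : Type*} [MeasurableSpace Y] {n : ℕ} :
    Measurable fun s : Fin (n + 1) → Y => (Fin.tail s : Fin n → Y) :=
  measurable_pi_lambda _ fun i => measurable_pi_apply i.succ

@[fun_prop]
theorem Measurable.interleave {Z : Type*} [MeasurableSpace Z] {p : ℕ} {t : Z → Fin p → ℝ≥0}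
    {c : Z → Fin (p + 1) → Conf} (ht : Measurable t) (hc : Measurable c) :
    Measurable fun z => interleave p (t z) (c z) := by
  induction p with
  | zero => exact (measurable_pi_apply 0).comp hc
  | succ p ih =>
    have h := ih (measurable_tail.comp ht) (measurable_tail.comp hc)
    have h0 := (measurable_pi_apply 0).comp ht
    have h1 := (measurable_pi_apply 0).comp hc
    exact measurable_confAppend.comp (h1.prodMk (measurable_consConf.comp (h0.prodMk h)))

theorem lintegral_pi_succ {Y : Type*} [MeasurableSpace Y] (μ : Measure Y) [SigmaFinite μ] (n : ℕ)
    {F : (Fin (n + 1) → Y) → ℝ≥0∞} (hF : Measurable F) :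
    ∫⁻ s, F s ∂(Measure.pi fun _ => μ) =
      ∫⁻ y, ∫⁻ s, F (Fin.cons y s) ∂(Measure.pi fun _ => μ) ∂μ := by
  rw [← (measurePreserving_consEquiv μ n).lintegral_comp hF, lintegral_prod]
  · simp only [consEquiv_apply]
  · exact (hF.comp (consEquiv Y n).measurable).aemeasurable

theorem measurable_fst_conf : Measurable fun c : Conf => (c.1 : ℝ≥0∞) :=
  measurable_of_conf fun n => (measurable_const : Measurable fun _ : Fin n → ℝ≥0 => (n : ℝ≥0∞))

/-- The true weight is the number of ways to choose `p` cut points in order; the cruder power is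
enough and suits induction. The first cut costs one factor of the length by `lintegral_cut`, the
remaining cuts take place in the tail. -/
theorem lintegral_interleave_le (p : ℕ) {F : Conf → ℝ≥0∞} (hF : Measurable F) :
    ∫⁻ t, ∫⁻ c, F (interleave p t c) ∂(Measure.pi fun _ => confMeasure)
      ∂(Measure.pi fun _ => volume) ≤ ∫⁻ c, (c.1 : ℝ≥0∞) ^ p * F c ∂confMeasure := by
  induction p generalizing F with
  | zero =>
    rw [Measure.pi_of_empty, lintegral_dirac]
    simp only [interleave, pow_zero, one_mul]
    exact ((measurePreserving_funUnique confMeasure (Fin 1)).lintegral_comp hF).le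
  | succ p ih =>
    have hm (q : ℕ) : Measurable fun c : Conf => (c.1 : ℝ≥0∞) ^ q * F c :=
      (measurable_fst_conf.pow_const q).mul hF
    have hi : Measurable fun z : (Fin (p + 1) → ℝ≥0) × (Fin (p + 1 + 1) → Conf) =>
        F (interleave (p + 1) z.1 z.2) :=
      hF.comp (measurable_fst.interleave measurable_snd)
    calc _ = ∫⁻ t : ℝ≥0, ∫⁻ t', ∫⁻ c, ∫⁻ c',
            F (confAppend (c, consConf (t, interleave p t' c')))
            ∂(Measure.pi fun _ => confMeasure) ∂confMeasure ∂(Measure.pi fun _ => volume)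
            ∂volume := by
          rw [lintegral_pi_succ _ _ hi.lintegral_prod_right']
          refine lintegral_congr fun t => lintegral_congr fun t' => ?_
          exact lintegral_pi_succ _ _ (hi.comp measurable_prodMk_left)
      _ = ∫⁻ t : ℝ≥0, ∫⁻ c, ∫⁻ t', ∫⁻ c',
            F (confAppend (c, consConf (t, interleave p t' c')))
            ∂(Measure.pi fun _ => confMeasure) ∂(Measure.pi fun _ => volume) ∂confMeasure
            ∂volume := by
          refine lintegral_congr fun t => lintegral_lintegral_swap (Measurable.aemeasurable ?_)
          refine Measurable.lintegral_prod_right'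
            (f := fun z : ((Fin p → ℝ≥0) × Conf) × (Fin (p + 1) → Conf) =>
              F (confAppend (z.1.2, consConf (t, interleave p z.1.1 z.2)))) ?_
          fun_prop
      _ ≤ ∫⁻ t : ℝ≥0, ∫⁻ c, ∫⁻ d, ((confAppend (c, consConf (t, d))).1 : ℝ≥0∞) ^ p *
            F (confAppend (c, consConf (t, d))) ∂confMeasure ∂confMeasure ∂volume := by
          refine lintegral_mono fun t => lintegral_mono fun c => ?_
          refine (ih (F := fun d => F (confAppend (c, consConf (t, d)))) ?_).trans ?_
          · fun_prop
          -- The tail `d` is part of the whole sequence, hence no longer than it.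
          · refine lintegral_mono fun d => mul_le_mul_left (pow_le_pow_left₀ zero_le ?_ _) _
            exact Nat.cast_le.2 (by simp only [confAppend, consConf]; omega)
      _ = ∫⁻ c, ∫⁻ t : ℝ≥0, ∫⁻ d, ((confAppend (c, consConf (t, d))).1 : ℝ≥0∞) ^ p *
            F (confAppend (c, consConf (t, d))) ∂confMeasure ∂volume ∂confMeasure := by
          refine lintegral_lintegral_swap (Measurable.aemeasurable ?_)
          refine Measurable.lintegral_prod_right' (f := fun z : (ℝ≥0 × Conf) × Conf =>
            ((confAppend (z.1.2, consConf (z.1.1, z.2))).1 : ℝ≥0∞) ^ p *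
              F (confAppend (z.1.2, consConf (z.1.1, z.2)))) ((hm p).comp ?_)
          fun_prop
      _ = ∫⁻ c, (c.1 : ℝ≥0∞) ^ (p + 1) * F c ∂confMeasure := by
          rw [lintegral_cut (hm p)]
          refine lintegral_congr fun c => ?_
          rw [pow_succ', mul_assoc]

/-- Apply the estimate to the indicator of a null set. Evaluating an `L²`-class at a concatenation
is thereby well defined; the quantifiers are iterated to match functions of `t` with values in an
`L²`-space. -/
theorem ae_interleave (p : ℕ) {P : Conf → Prop} (h : ∀ᵐ c ∂confMeasure, P c) :
    ∀ᵐ t ∂(volume : Measure (Fin p → ℝ≥0)), ∀ᵐ c ∂(Measure.pi fun _ : Fin (p + 1) => confMeasure),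
      P (interleave p t c) := by
  obtain ⟨N, hN, hNm, hN0⟩ := exists_measurable_superset_of_null (ae_iff.1 h)
  have hF : Measurable (N.indicator (1 : Conf → ℝ≥0∞)) := measurable_one.indicator hNm
  have hi : Measurable fun z : (Fin p → ℝ≥0) × (Fin (p + 1) → Conf) =>
      N.indicator (1 : Conf → ℝ≥0∞) (interleave p z.1 z.2) :=
    hF.comp (measurable_fst.interleave measurable_snd)
  have h1 : ∫⁻ t, ∫⁻ c, N.indicator 1 (interleave p t c) ∂(Measure.pi fun _ => confMeasure)
      ∂(Measure.pi fun _ => volume) = (0 : ℝ≥0∞) := by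
    refine le_antisymm ((lintegral_interleave_le p hF).trans_eq ?_) zero_le
    refine lintegral_eq_zero_of_ae_eq_zero ?_
    have : ∀ᵐ c ∂confMeasure, c ∉ N := measure_eq_zero_iff_ae_notMem.1 hN0
    filter_upwards [this] with c hc
    simp [hc]
  rw [lintegral_eq_zero_iff hi.lintegral_prod_right'] at h1
  filter_upwards [h1] with t ht
  have h2 := (lintegral_eq_zero_iff (hi.comp measurable_prodMk_left)).1 ht
  filter_upwards [h2] with c hc
  by_contra hP
  simp [hN hP] at hc

end Concatenation

end WignerSpace

end

noncomputable section

namespace WignerSpace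

/-! ### The pointwise formula for the iterated derivative on the algebra. -/

section Pointwise

/-- The list of entries of a finite sequence. -/
def confList (c : Conf) : List ℝ≥0 := List.ofFn c.2

theorem confList_append (z : Conf × Conf) : confList (confAppend z) = confList z.1 ++ confList z.2 :=
  List.ofFn_fin_append _ _

theorem confList_consConf (z : ℝ≥0 × Conf) : confList (consConf z) = z.1 :: confList z.2 := by
  simp [confList, consConf]

theorem length_confList (c : Conf) : (confList c).length = c.1 := List.length_ofFn

theorem confList_injective : Function.Injective confList :=
  (List.equivSigmaTuple (α := ℝ≥0)).symm.injective

/-- The function `(s₁, …, sₙ) ↦ h₁(s₁) ⋯ hₙ(sₙ)` on finite sequences; it vanishes on the sequences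
of a length other than `n`. -/
def tensorFun : List HilbertR → List ℝ≥0 → ℂ
  | [], [] => 1
  | h :: l, x :: s => complexify h x * tensorFun l s
  | _, _ => 0

/-- The pointwise form of `sum_splits_ipList`: only the cut after as many letters as `s` has entries
survives. -/
theorem sum_splits_tensorFun (l : List HilbertR) (t : ℝ≥0) (s s' : List ℝ≥0) :
    ((splits l).map fun x => complexify x.2.1 t * (tensorFun x.1 s * tensorFun x.2.2 s')).sum =
      tensorFun l (s ++ t :: s') := by
  induction l generalizing s with
  | nil => cases s <;> rfl
  | cons h l ih =>
    cases s with
    | nil =>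
      simp only [splits, List.map_cons, List.map_map, List.sum_cons, List.nil_append]
      rw [List.sum_eq_zero]
      · simp [tensorFun]
      · simp only [List.mem_map, Function.comp_apply]
        rintro _ ⟨x, -, rfl⟩
        simp [tensorFun]
    | cons a s =>
      simp only [splits, List.map_cons, List.map_map, List.sum_cons, List.cons_append]
      rw [tensorFun, ← ih s, ← List.sum_map_mul_left]
      simp only [tensorFun, Function.comp_def, zero_mul, mul_zero, zero_add]
      congr 2
      funext x
      ring

theorem elemTensor_apply (l : List HilbertR) :
    ∀ᵐ c ∂confMeasure, elemTensor l c = tensorFun l (confList c) := by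
  induction l with
  | nil =>
    refine ae_conf fun n => ?_
    cases n with
    | zero =>
      filter_upwards [vacuum_zero] with s hs
      rw [elemTensor, hs]
      simp [confList, toConf, tensorFun]
    | succ n =>
      filter_upwards [vacuum_succ n] with s hs
      rw [elemTensor, hs]
      simp [confList, toConf, tensorFun]
  | cons h l ih =>
    refine ae_conf fun n => ?_
    cases n with
    | zero =>
      filter_upwards [creation_zero (complexify h) (elemTensor l)] with s hs
      rw [elemTensor, hs]
      simp [confList, toConf, tensorFun]
    | succ n =>
      have h1 : ∀ᵐ z ∂((volume : Measure ℝ≥0).prod (Measure.pi fun _ : Fin n => volume)),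
          elemTensor l (toConf n z.2) = tensorFun l (confList (toConf n z.2)) :=
        Measure.quasiMeasurePreserving_snd.ae (ae_toConf ih n)
      filter_upwards [creation_succ (complexify h) (elemTensor l) n, ae_cons h1] with s h2 h3
      rw [elemTensor, h2, h3]
      simp only [confList, toConf, List.ofFn_succ, tensorFun]
      rfl

theorem ae_tail {Y : Type*} [MeasurableSpace Y] {μ : Measure Y} [SigmaFinite μ] {n : ℕ}
    {P : (Fin n → Y) → Prop} (h : ∀ᵐ z ∂(Measure.pi fun _ => μ), P z) :
    ∀ᵐ s ∂(Measure.pi fun _ : Fin (n + 1) => μ), P (Fin.tail s) :=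
  ae_cons (P := fun z => P z.2) (Measure.quasiMeasurePreserving_snd.ae h)

theorem ae_head {Y : Type*} [MeasurableSpace Y] {μ : Measure Y} [SigmaFinite μ] {n : ℕ}
    {P : Y → Prop} (h : ∀ᵐ y ∂μ, P y) : ∀ᵐ s ∂(Measure.pi fun _ : Fin (n + 1) => μ), P (s 0) :=
  ae_cons (P := fun z => P z.1) (Measure.quasiMeasurePreserving_fst.ae h)

/-- `U(t)(c) = f(t, c)` for almost all `t` and `c`. -/
def AgreesWith {p : ℕ} (U : RandomField p) (f : (Fin p → ℝ≥0) → (Fin (p + 1) → Conf) → ℂ) : Prop :=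
  ∀ᵐ t ∂(volume : Measure (Fin p → ℝ≥0)),
    ∀ᵐ c ∂(Measure.pi fun _ : Fin (p + 1) => confMeasure), U t c = f t c

theorem AgreesWith.add {p : ℕ} {U V : RandomField p}
    {f g : (Fin p → ℝ≥0) → (Fin (p + 1) → Conf) → ℂ} (hU : AgreesWith U f) (hV : AgreesWith V g) :
    AgreesWith (U + V) fun t c => f t c + g t c := by
  filter_upwards [hU, hV, Lp.coeFn_add U V] with t h1 h2 h3
  rw [h3, Pi.add_apply]
  filter_upwards [h1, h2, Lp.coeFn_add (U t) (V t)] with c h4 h5 h6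
  rw [h6, Pi.add_apply, h4, h5]

theorem AgreesWith.smul {p : ℕ} {U : RandomField p}
    {f : (Fin p → ℝ≥0) → (Fin (p + 1) → Conf) → ℂ} (hU : AgreesWith U f) (a : ℂ) :
    AgreesWith (a • U) fun t c => a * f t c := by
  filter_upwards [hU, Lp.coeFn_smul a U] with t h1 h3
  rw [h3, Pi.smul_apply]
  filter_upwards [h1, Lp.coeFn_smul a (U t)] with c h4 h6
  rw [h6, Pi.smul_apply, h4, smul_eq_mul]

theorem agreesWith_zero {p : ℕ} : AgreesWith (0 : RandomField p) fun _ _ => 0 := by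
  filter_upwards [Lp.coeFn_zero (Legs (p + 1)) 2 (volume : Measure (Fin p → ℝ≥0))] with t h1
  rw [h1, Pi.zero_apply]
  exact Lp.coeFn_zero ℂ 2 _

theorem AgreesWith.list_sum {p : ℕ} {ι : Type*} {U : ι → RandomField p}
    {f : ι → (Fin p → ℝ≥0) → (Fin (p + 1) → Conf) → ℂ} (h : ∀ i, AgreesWith (U i) (f i))
    (L : List ι) : AgreesWith (L.map U).sum fun t c => (L.map fun i => f i t c).sum := by
  induction L with
  | nil => exact agreesWith_zero
  | cons i L ih => exact (h i).add ih

theorem AgreesWith.glue {p : ℕ} {U : RandomField p}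
    {f : (Fin p → ℝ≥0) → (Fin (p + 1) → Conf) → ℂ} (hU : AgreesWith U f) (h : HilbertC)
    (X : SCalg) {g : Conf → ℂ} (hX : ∀ᵐ c ∂confMeasure, toVector X c = g c) :
    AgreesWith (glue p (h ⊗ₜ (X ⊗ₜ U)))
      fun t c => h (t 0) * (g (c 0) * f (Fin.tail t) (Fin.tail c)) := by
  have h1 : WignerSpace.glue p (h ⊗ₜ (X ⊗ₜ U)) =
      consTensor volume (Legs (p + 2)) p h (attachLeg p X U) := rfl
  rw [h1]
  have h2 : ∀ᵐ t ∂(volume : Measure (Fin p → ℝ≥0)),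
      attachLeg p X U t = consTensor confMeasure ℂ (p + 1) (toVector X) (U t) :=
    (consTensor confMeasure ℂ (p + 1) (toVector X)).coeFn_compLp U
  filter_upwards [consTensor_apply volume h (attachLeg p X U), ae_tail h2, ae_tail hU]
    with t h3 h4 h5
  rw [h3, h4]
  filter_upwards [Lp.coeFn_smul (h (t 0)) (consTensor confMeasure ℂ (p + 1) (toVector X)
      (U (Fin.tail t))), consTensor_apply confMeasure (toVector X) (U (Fin.tail t)), ae_tail h5,
    ae_head hX] with c h6 h7 h8 h9
  rw [h6, Pi.smul_apply, h7, h8, h9, smul_eq_mul, smul_eq_mul]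

theorem iterGradient_zero_apply (X : SCalg) {g : Conf → ℂ}
    (hX : ∀ᵐ c ∂confMeasure, toVector X c = g c) :
    AgreesWith (iterGradient 0 X) fun _ c => g (c 0) := by
  have h1 : iterGradient 0 X = Lp.const 2 (volume : Measure (Fin 0 → ℝ≥0))
      (consTensor confMeasure ℂ 0 (toVector X)
        (Lp.const 2 (Measure.pi fun _ : Fin 0 => confMeasure) 1)) := rfl
  rw [h1]
  filter_upwards [Lp.coeFn_const 2 (volume : Measure (Fin 0 → ℝ≥0))
    (consTensor confMeasure ℂ 0 (toVector X)
        (Lp.const 2 (Measure.pi fun _ : Fin 0 => confMeasure) 1))] with t h2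
  rw [h2]
  filter_upwards [consTensor_apply confMeasure (toVector X)
    (Lp.const 2 (Measure.pi fun _ : Fin 0 => confMeasure) (1 : ℂ)), ae_head hX,
    ae_tail (Lp.coeFn_const 2 (Measure.pi fun _ : Fin 0 => confMeasure) (1 : ℂ))] with c h3 h4 h5
  rw [Function.const_apply, h3, h4, h5]
  simp

theorem iterGradient_succ_wick (p : ℕ) (l : List HilbertR) :
    iterGradient (p + 1) (wick field l) = ((splits l).map fun x => glue p
      (complexify x.2.1 ⊗ₜ[ℂ] (wick field x.1 ⊗ₜ[ℂ] iterGradient p (wick field x.2.2)))).sum := by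
  change glue p (LinearMap.lTensor HilbertC (LinearMap.lTensor SCalg (iterGradient p))
    (gradient (wick field l))) = _
  rw [gradient_wick, map_list_sum, map_list_sum, List.map_map, List.map_map]
  rfl

/-- The first derivative cuts the word at the letter evaluated at `t₁`, the others act on the last
leg by induction, and the sum over the cuts reassembles the word at the concatenated point. -/
theorem iterGradient_wick (p : ℕ) (l : List HilbertR) :
    AgreesWith (iterGradient p (wick field l))
      fun t c => tensorFun l (confList (interleave p t c)) := by
  have hw (l) : ∀ᵐ c ∂confMeasure, toVector (wick field l) c = tensorFun l (confList c) := by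
    rw [toVector_wick]
    exact elemTensor_apply l
  induction p generalizing l with
  | zero => exact iterGradient_zero_apply _ (hw l)
  | succ p ih =>
    rw [iterGradient_succ_wick]
    have h := AgreesWith.list_sum (fun x : List HilbertR × HilbertR × List HilbertR =>
      (ih x.2.2).glue (complexify x.2.1) (wick field x.1) (hw x.1)) (splits l)
    filter_upwards [h] with t ht
    filter_upwards [ht] with c hc
    rw [hc, sum_splits_tensorFun, interleave, confList_append, confList_consConf]

/-- `∇ᵖ X` is the function `(t, c) ↦ (X Ω)(c₀ t₁ c₁ ⋯ tₚ cₚ)`. -/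
theorem iterGradient_apply (p : ℕ) (X : SCalg) :
    AgreesWith (iterGradient p X) fun t c => toVector X (interleave p t c) := by
  induction X using wick_field_induction with
  | hw l =>
    have h : ∀ᵐ c ∂confMeasure, toVector (wick field l) c = tensorFun l (confList c) := by
      rw [toVector_wick]
      exact elemTensor_apply l
    filter_upwards [iterGradient_wick p l, ae_interleave p h] with t h1 h2
    filter_upwards [h1, h2] with c h3 h4
    rw [h3, h4]
  | h0 =>
    rw [map_zero, map_zero]
    filter_upwards [agreesWith_zero (p := p),
      ae_interleave p (Lp.coeFn_zero ℂ 2 confMeasure)] with t h1 h2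
    filter_upwards [h1, h2] with c h3 h4
    rw [h3, h4, Pi.zero_apply]
  | hadd X Y hX hY =>
    rw [map_add, map_add]
    filter_upwards [hX.add hY, ae_interleave p (Lp.coeFn_add (toVector X) (toVector Y))] with t h1 h2
    filter_upwards [h1, h2] with c h3 h4
    rw [h3, h4, Pi.add_apply]
  | hsmul a X hX =>
    rw [map_smul, map_smul]
    filter_upwards [hX.smul a, ae_interleave p (Lp.coeFn_smul a (toVector X))] with t h1 h2
    filter_upwards [h1, h2] with c h3 h4
    rw [h3, h4, Pi.smul_apply, smul_eq_mul]

/-- Each derivative uses up at least one letter of the leg on which the later ones act, so the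
letters run out before the derivatives do. -/
theorem iterGradient_wick_eq_zero {p : ℕ} {l : List HilbertR} (h : l.length < p) :
    iterGradient p (wick field l) = 0 := by
  induction p generalizing l with
  | zero => exact absurd h (Nat.not_lt_zero _)
  | succ p ih =>
    rw [iterGradient_succ_wick]
    refine List.sum_eq_zero fun y hy => ?_
    obtain ⟨x, hx, rfl⟩ := List.mem_map.1 hy
    rw [ih (by have := length_of_mem_splits hx; omega), tmul_zero, tmul_zero, map_zero]

end Pointwise

/-! ### Closability, and the closed operator. -/

section Closure

open Filter Topology

/-- The pairs `(φ, U)` with `U(t)(c) = φ(c₀ t₁ c₁ ⋯ tₚ cₚ)`. -/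
def cutGraph (p : ℕ) : Set (Fock × RandomField p) :=
  {z | AgreesWith z.2 fun t c => z.1 (interleave p t c)}

theorem mem_cutGraph {p : ℕ} {z : Fock × RandomField p} :
    z ∈ cutGraph p ↔ AgreesWith z.2 fun t c => z.1 (interleave p t c) := Iff.rfl

theorem exists_seq_tendsto_ae_of_tendsto_Lp {X E : Type*} [MeasurableSpace X] {μ : Measure X}
    [NormedAddCommGroup E] {f : ℕ → Lp E 2 μ} {g : Lp E 2 μ} (h : Tendsto f atTop (𝓝 g)) :
    ∃ ns : ℕ → ℕ, StrictMono ns ∧ ∀ᵐ x ∂μ, Tendsto (fun i => f (ns i) x) atTop (𝓝 (g x)) :=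
  (tendstoInMeasure_of_tendsto_Lp h).exists_seq_tendsto_ae

/-- `L²`-convergence gives almost everywhere convergence along subsequences, and `ae_interleave`
transports it to concatenated points, so the defining identity passes to the limit. -/
theorem isClosed_cutGraph (p : ℕ) : IsClosed (cutGraph p) := by
  refine IsSeqClosed.isClosed fun z y hz hy => ?_
  obtain ⟨hy1, hy2⟩ := (Prod.tendsto_iff _ _).1 hy
  obtain ⟨n1, hn1, h1⟩ := exists_seq_tendsto_ae_of_tendsto_Lp hy1
  obtain ⟨n2, hn2, h2⟩ := exists_seq_tendsto_ae_of_tendsto_Lp (hy2.comp hn1.tendsto_atTop)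
  have h3 : ∀ᵐ t ∂(volume : Measure (Fin p → ℝ≥0)), ∀ k,
      ∀ᵐ c ∂(Measure.pi fun _ : Fin (p + 1) => confMeasure),
        (z k).2 t c = (z k).1 (interleave p t c) := ae_all_iff.2 hz
  rw [mem_cutGraph]
  filter_upwards [ae_interleave p h1, h2, h3] with t h4 h5 h6
  -- This third subsequence depends on `t`, which is harmless: the limits in `c` are compared for
  -- fixed `t`.
  obtain ⟨n3, hn3, h7⟩ := exists_seq_tendsto_ae_of_tendsto_Lp h5
  filter_upwards [h4, h7, ae_all_iff.2 h6] with c h8 h9 h10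
  refine tendsto_nhds_unique h9 ?_
  simp only [Function.comp_apply, h10]
  exact h8.comp (hn2.comp hn3).tendsto_atTop

/-- A set containing the closure of the graph has no vertical vectors: this is closability. -/
theorem eq_zero_of_mem_cutGraph {p : ℕ} {U : RandomField p} (h : ((0 : Fock), U) ∈ cutGraph p) :
    U = 0 := by
  refine Lp.ext ?_
  filter_upwards [mem_cutGraph.1 h, ae_interleave p (Lp.coeFn_zero ℂ 2 confMeasure),
    Lp.coeFn_zero (Legs (p + 1)) 2 (volume : Measure (Fin p → ℝ≥0))] with t h1 h2 h3
  rw [h3, Pi.zero_apply]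
  refine Lp.ext ?_
  filter_upwards [h1, h2, Lp.coeFn_zero ℂ 2 (Measure.pi fun _ : Fin (p + 1) => confMeasure)]
    with c h4 h5 h6
  rw [h4, h5, h6]
  rfl

/-- The graph of `∇ᵖ` on `𝒮𝒞_alg`. -/
def gradientGraph (p : ℕ) : Submodule ℂ (Fock × RandomField p) :=
  LinearMap.range (toVector.prod (iterGradient p))

theorem mem_gradientGraph (p : ℕ) (X : SCalg) :
    (toVector X, iterGradient p X) ∈ gradientGraph p := ⟨X, rfl⟩

theorem closure_gradientGraph_subset (p : ℕ) :
    ((gradientGraph p).topologicalClosure : Set (Fock × RandomField p)) ⊆ cutGraph p := by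
  rw [Submodule.topologicalClosure_coe]
  refine closure_minimal ?_ (isClosed_cutGraph p)
  rintro _ ⟨X, rfl⟩
  exact iterGradient_apply p X

/-- Turning a subspace into an operator, and taking the closure of an operator, are meaningful only
for single-valued relations. Both conditions come from the inclusion in `cutGraph`. -/
theorem graph_malliavin (p : ℕ) : (malliavin p).graph = (gradientGraph p).topologicalClosure := by
  have h1 : ∀ z ∈ (gradientGraph p).topologicalClosure, z.1 = 0 → z.2 = 0 := by
    rintro ⟨φ, U⟩ hz (rfl : φ = 0)
    exact eq_zero_of_mem_cutGraph (closure_gradientGraph_subset p hz)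
  have h2 : (malliavinAlg p).graph = gradientGraph p :=
    Submodule.toLinearPMap_graph_eq _ fun z hz => h1 z (Submodule.le_topologicalClosure _ hz)
  have h3 : (malliavinAlg p).IsClosable :=
    ⟨(gradientGraph p).topologicalClosure.toLinearPMap, by
      rw [Submodule.toLinearPMap_graph_eq _ h1, h2]⟩
  rw [malliavin, ← h3.graph_closure_eq_closure_graph, h2]

theorem exists_mem_domain_malliavin {p : ℕ} {φ : Fock} {U : RandomField p}
    (h : (φ, U) ∈ (gradientGraph p).topologicalClosure) :
    ∃ hφ : φ ∈ (malliavin p).domain, malliavin p ⟨φ, hφ⟩ = U := by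
  rw [← graph_malliavin] at h
  have hφ := LinearPMap.mem_domain_of_mem_graph h
  refine ⟨hφ, ?_⟩
  exact LinearPMap.mem_graph_snd_inj _ ((malliavin p).mem_graph ⟨φ, hφ⟩) h rfl

theorem agreesWith_of_mem_closure {p : ℕ} {φ : Fock} {U : RandomField p}
    (h : (φ, U) ∈ (gradientGraph p).topologicalClosure) :
    AgreesWith U fun t c => φ (interleave p t c) := by
  have h1 : (φ, U) ∈ cutGraph p := closure_gradientGraph_subset p h
  exact h1

theorem agreesWith_malliavin {p : ℕ} {φ : Fock} (hφ : φ ∈ (malliavin p).domain) :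
    AgreesWith (p := p) (malliavin p ⟨φ, hφ⟩) fun t c => φ (interleave p t c) := by
  have h : (φ, malliavin p ⟨φ, hφ⟩) ∈ (malliavin p).graph := (malliavin p).mem_graph ⟨φ, hφ⟩
  rw [graph_malliavin] at h
  exact agreesWith_of_mem_closure h

theorem iterGradient_wickSpan {p n : ℕ} (hpn : n < p) {X : SCalg} (hX : X ∈ wickSpan field n) :
    iterGradient p X = 0 := by
  rw [wickSpan] at hX
  induction hX using Submodule.span_induction with
  | mem X hX =>
    obtain ⟨l, hl, rfl⟩ := hX
    rw [mem_ofPred_eq] at hl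
    exact iterGradient_wick_eq_zero (hl.trans_lt hpn)
  | zero => exact map_zero _
  | add X Y _ _ hX hY => rw [map_add, hX, hY, add_zero]
  | smul c X _ hX => rw [map_smul, hX, smul_zero]

/-- The vectors `F` with `(F, 0)` in the closed graph form a closed subspace, so it is enough that
it contains the generating products. -/
theorem finiteChaos_subset {p n : ℕ} (hpn : n < p) {F : Fock} (hF : F ∈ finiteChaos n) :
    (F, (0 : RandomField p)) ∈ (gradientGraph p).topologicalClosure := by
  have h1 : finiteChaos n ≤
      ((gradientGraph p).topologicalClosure).comap (LinearMap.inl ℂ Fock (RandomField p)) := by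
    refine Submodule.topologicalClosure_minimal _ (Submodule.span_le.2 ?_) ?_
    · rintro _ ⟨k, hk, h, rfl⟩
      refine Submodule.le_topologicalClosure _ ?_
      have h2 := mem_gradientGraph p (List.ofFn fun i => field (h i)).prod
      rwa [iterGradient_wickSpan hpn (prod_ofFn_mem_wickSpan field hk h)] at h2
    · exact (Submodule.isClosed_topologicalClosure _).preimage
        (ContinuousLinearMap.inl ℂ Fock (RandomField p)).continuous
  exact h1 hF

end Closure

end WignerSpace

end

noncomputable section

namespace WignerSpace

/-! ### Combinatorics: block lengths versus slots. -/

section Blocks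

/-- For block lengths `m₀, …, mₚ`, the position of the first entry of the `j`-th block in
`c₀ t₁ c₁ ⋯ tₚ cₚ`. -/
def blockOffset : (p : ℕ) → (Fin (p + 1) → ℕ) → Fin (p + 1) → ℕ
  | 0, _, _ => 0
  | p + 1, m, j => Fin.cases 0 (fun j => m 0 + 1 + blockOffset p (Fin.tail m) j) j

theorem blockOffset_zero (p : ℕ) (m : Fin (p + 1) → ℕ) : blockOffset p m 0 = 0 := by
  cases p <;> rfl

theorem blockOffset_succ_succ (p : ℕ) (m : Fin (p + 2) → ℕ) (j : Fin (p + 1)) :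
    blockOffset (p + 1) m j.succ = m 0 + 1 + blockOffset p (Fin.tail m) j := rfl

/-- The definition unrolls from the first block, while slots need the step between neighbours; the
extra `1` is the entry `t` between two blocks. -/
theorem blockOffset_succ {p : ℕ} (m : Fin (p + 1) → ℕ) (q : Fin p) :
    blockOffset p m q.succ = blockOffset p m q.castSucc + m q.castSucc + 1 := by
  induction p with
  | zero => exact q.elim0
  | succ p ih =>
    rw [blockOffset_succ_succ]
    induction q using Fin.cases with
    | zero => rw [Fin.castSucc_zero, blockOffset_zero, blockOffset_zero, add_zero, zero_add]
    | succ r =>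
      rw [ih, Fin.castSucc_succ, blockOffset_succ_succ]
      simp only [Fin.tail]
      omega

theorem blockOffset_monotone {p : ℕ} (m : Fin (p + 1) → ℕ) : Monotone (blockOffset p m) :=
  Fin.monotone_iff_le_succ.2 fun q => by rw [blockOffset_succ]; omega

variable {p : ℕ} (t : Fin p → ℝ≥0) (c : Fin (p + 1) → Conf)

theorem length_interleave : (interleave p t c).1 =
    blockOffset p (fun j => (c j).1) (Fin.last p) + (c (Fin.last p)).1 := by
  induction p with
  | zero => simp [interleave, blockOffset]
  | succ p ih =>
    rw [← Fin.succ_last, blockOffset_succ_succ]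
    simp only [interleave, confAppend, consConf, ih, Fin.tail_def]
    omega

theorem confList_interleave_succ (t : Fin (p + 1) → ℝ≥0) (c : Fin (p + 2) → Conf) :
    confList (interleave (p + 1) t c) =
      confList (c 0) ++ t 0 :: confList (interleave p (Fin.tail t) (Fin.tail c)) := by
  rw [interleave, confList_append, confList_consConf]

/-- Positions are read in lists with optional lookup, so that indices stay plain naturals although
the total length depends on `c`. -/
theorem confList_interleave_block (j : Fin (p + 1)) (k : Fin (c j).1) :
    (confList (interleave p t c))[blockOffset p (fun j => (c j).1) j + k]? = some ((c j).2 k) := by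
  induction p with
  | zero =>
    obtain rfl : j = 0 := Fin.eq_zero j
    simp [interleave, blockOffset, confList]
    rfl
  | succ p ih =>
    rw [confList_interleave_succ]
    induction j using Fin.cases with
    | zero =>
      rw [blockOffset_zero, zero_add, List.getElem?_append_left (by simp [length_confList])]
      simp [confList]
      rfl
    | succ j =>
      rw [blockOffset_succ_succ, List.getElem?_append_right (by rw [length_confList]; omega),
        length_confList]
      have h : (c 0).1 + 1 + blockOffset p (Fin.tail fun j => (c j).1) j + k - (c 0).1 =
          blockOffset p (fun j => (Fin.tail c j).1) j + k + 1 := by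
        simp only [Fin.tail_def]
        omega
      rw [h, List.getElem?_cons_succ]
      exact ih (Fin.tail t) (Fin.tail c) j k

theorem confList_interleave_slot (q : Fin p) : (confList (interleave p t c))[
    blockOffset p (fun j => (c j).1) q.castSucc + (c q.castSucc).1]? = some (t q) := by
  induction p with
  | zero => exact q.elim0
  | succ p ih =>
    rw [confList_interleave_succ]
    induction q using Fin.cases with
    | zero =>
      rw [Fin.castSucc_zero, blockOffset_zero, zero_add,
        List.getElem?_append_right (by rw [length_confList]), length_confList, Nat.sub_self,
        List.getElem?_cons_zero]
    | succ q =>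
      rw [Fin.castSucc_succ, blockOffset_succ_succ,
        List.getElem?_append_right (by rw [length_confList]; omega), length_confList]
      have h : (c 0).1 + 1 + blockOffset p (Fin.tail fun j => (c j).1) q.castSucc +
          (c q.castSucc.succ).1 - (c 0).1 =
          blockOffset p (fun j => (Fin.tail c j).1) q.castSucc + (Fin.tail c q.castSucc).1 + 1 := by
        simp only [Fin.tail_def]
        omega
      rw [h, List.getElem?_cons_succ]
      exact ih (Fin.tail t) (Fin.tail c) q

variable {n : ℕ} (i : Fin p ↪o Fin n)

/-- Strict monotonicity of the slots ensures that the truncated subtraction in `blockLength` loses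
nothing. -/
theorem blockStart_le_blockEnd (j : Fin (p + 1)) : blockStart i j ≤ blockEnd i j := by
  induction j using Fin.cases with
  | zero => simp [blockStart]
  | succ r =>
    rcases Fin.eq_castSucc_or_eq_last r.succ with ⟨q, hq⟩ | hq
    · have hrq : r < q := by rw [← Fin.castSucc_lt_castSucc_iff, ← hq]; exact Fin.castSucc_lt_succ
      have h : (i r : ℕ) < i q := i.strictMono hrq
      rw [hq]
      simp only [blockEnd, Fin.lastCases_castSucc]
      rw [← hq]
      simp only [blockStart, Fin.cases_succ]
      omega
    · have h := (i r).2
      rw [hq]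
      simp only [blockEnd, Fin.lastCases_last]
      rw [← hq]
      simp only [blockStart, Fin.cases_succ]
      omega

theorem blockEnd_eq (j : Fin (p + 1)) : blockEnd i j = blockStart i j + blockLength i j := by
  have := blockStart_le_blockEnd i j
  unfold blockLength
  omega

theorem slot_eq (q : Fin p) :
    (i q : ℕ) = blockStart i q.castSucc + blockLength i q.castSucc := by
  rw [← blockEnd_eq, blockEnd, Fin.lastCases_castSucc]

theorem blockStart_eq (j : Fin (p + 1)) : blockStart i j = blockOffset p (blockLength i) j := by
  induction j using Fin.induction with
  | zero => rw [blockOffset_zero]; rfl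
  | succ q ih =>
    rw [blockOffset_succ, ← ih, ← slot_eq]
    rfl

/-- The slots are recovered from the lengths as block offset plus length; hence a tuple of blocks
belongs to at most one choice of slots. -/
theorem blockLength_injective : Function.Injective
    (blockLength : (Fin p ↪o Fin n) → Fin (p + 1) → ℕ) := by
  intro i i' h
  refine DFunLike.ext _ _ fun q => Fin.ext ?_
  rw [slot_eq, slot_eq, blockStart_eq, blockStart_eq, h]

/-- Compares the entries one by one: by `slot_or_block` each position is either a slot or lies in a
block. -/
theorem interleave_toConfs (s : ∀ j, Fin (blockLength i j) → ℝ≥0) :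
    interleave p t (toConfs (blockLength i) s) = toConf n (insertAt i t s) := by
  have hlen : (interleave p t (toConfs (blockLength i) s)).1 = n := by
    rw [length_interleave]
    change blockOffset p (blockLength i) _ + blockLength i _ = n
    rw [← blockStart_eq, ← blockEnd_eq, blockEnd, Fin.lastCases_last]
  refine confList_injective (List.ext_getElem? fun l => ?_)
  by_cases hl : l < n
  · have hr : (confList (toConf n (insertAt i t s)))[l]? = some (insertAt i t s ⟨l, hl⟩) := by
      simp [confList, toConf, hl]
      rfl
    rw [hr]
    rcases slot_or_block i ⟨l, hl⟩ with ⟨q, hq⟩ | ⟨x, hx⟩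
    · have h := confList_interleave_slot t (toConfs (blockLength i) s) q
      change (confList _)[blockOffset p (blockLength i) _ + blockLength i _]? = _ at h
      rw [← blockStart_eq, ← slot_eq, hq] at h
      rw [← hq, insertAt_slot]
      exact h
    · have h := confList_interleave_block t (toConfs (blockLength i) s) x.1 x.2
      change (confList _)[blockOffset p (blockLength i) _ + x.2]? = some (s x.1 x.2) at h
      rw [← blockStart_eq] at h
      rw [← hx, insertAt_block, ← h]
      congr 1
      exact (congrArg Fin.val hx).symm
  · rw [List.getElem?_eq_none (by rw [length_confList, hlen]; omega),
      List.getElem?_eq_none (by rw [length_confList]; exact not_lt.1 hl)]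

theorem exists_blockLength (h : (interleave p t c).1 = n) :
    ∃ i : Fin p ↪o Fin n, ∀ j, (c j).1 = blockLength i j := by
  set m : Fin (p + 1) → ℕ := fun j => (c j).1
  rw [length_interleave] at h
  change blockOffset p m (Fin.last p) + m (Fin.last p) = n at h
  have hlt : ∀ q q' : Fin p, q < q' → blockOffset p m q.castSucc + m q.castSucc <
      blockOffset p m q'.castSucc + m q'.castSucc := by
    intro q q' hq
    have h1 := blockOffset_monotone m (show q.succ ≤ q'.castSucc from hq)
    rw [blockOffset_succ] at h1
    omega
  have hn : ∀ q : Fin p, blockOffset p m q.castSucc + m q.castSucc < n := by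
    intro q
    have h1 := blockOffset_monotone m (Fin.le_last q.succ)
    rw [blockOffset_succ] at h1
    omega
  -- The slot `i q` is the position just after block `q`, where `t q` stands in the concatenation.
  let i : Fin p ↪o Fin n := OrderEmbedding.ofStrictMono
    (fun q => ⟨blockOffset p m q.castSucc + m q.castSucc, hn q⟩) fun q q' hq => hlt q q' hq
  have hstart : ∀ j, blockStart i j = blockOffset p m j := by
    intro j
    induction j using Fin.cases with
    | zero => rw [blockOffset_zero]; rfl
    | succ q => rw [blockOffset_succ]; rfl
  have hend : ∀ j, blockEnd i j = blockOffset p m j + m j := by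
    intro j
    induction j using Fin.lastCases with
    | last => rw [blockEnd, Fin.lastCases_last]; exact h.symm
    | cast q => rw [blockEnd, Fin.lastCases_castSucc]; rfl
  refine ⟨i, fun j => ?_⟩
  rw [blockLength, hstart, hend]
  exact (Nat.add_sub_cancel_left ..).symm

end Blocks

end WignerSpace

end

noncomputable section

namespace WignerSpace

/-! ### Boundedness on a chaos and membership in the domain. -/

section Domain

open Filter Topology

theorem enorm_sq_Lp {X E : Type*} [MeasurableSpace X] {μ : Measure X} [NormedAddCommGroup E]
    (f : Lp E 2 μ) : ‖f‖ₑ ^ 2 = ∫⁻ x, ‖f x‖ₑ ^ 2 ∂μ := by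
  rw [Lp.enorm_def, eLpNorm_eq_lintegral_rpow_enorm_toReal two_ne_zero ofNat_ne_top,
    ← ENNReal.rpow_natCast, ← ENNReal.rpow_mul]
  simp

/-- On the `n`-th chaos, `∇ᵖ` is bounded. -/
theorem enorm_iterGradient_le (p : ℕ) {n : ℕ} {X : SCalg}
    {f : Lp ℂ 2 (volume : Measure (Fin n → ℝ≥0))} (hX : toVector X = wignerIntegral n f) :
    ‖iterGradient p X‖ₑ ^ 2 ≤ (n : ℝ≥0∞) ^ p * ‖f‖ₑ ^ 2 := by
  have hF : Measurable fun c => ‖toVector X c‖ₑ ^ 2 :=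
    (Lp.stronglyMeasurable (toVector X)).measurable.enorm.pow_const 2
  calc ‖iterGradient p X‖ₑ ^ 2
      = ∫⁻ t, ∫⁻ c, ‖toVector X (interleave p t c)‖ₑ ^ 2 ∂(Measure.pi fun _ => confMeasure)
          ∂(Measure.pi fun _ => volume) := by
        rw [enorm_sq_Lp]
        refine lintegral_congr_ae ?_
        filter_upwards [iterGradient_apply p X] with t ht
        rw [enorm_sq_Lp]
        refine lintegral_congr_ae ?_
        filter_upwards [ht] with c hc
        rw [hc]
    _ ≤ ∫⁻ c, (c.1 : ℝ≥0∞) ^ p * ‖toVector X c‖ₑ ^ 2 ∂confMeasure := lintegral_interleave_le p hF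
    -- A vector of the `n`-th chaos vanishes on sequences of any other length, so the weight is
    -- constant where it matters.
    _ = ∫⁻ c, (n : ℝ≥0∞) ^ p * ‖toVector X c‖ₑ ^ 2 ∂confMeasure := by
        refine lintegral_congr_ae (ae_conf fun k => ?_)
        by_cases hk : k = n
        · subst hk
          exact .of_forall fun s => rfl
        · filter_upwards [wignerIntegral_ne hk f] with s hs
          rw [hX, hs]
          simp
    _ = (n : ℝ≥0∞) ^ p * ‖f‖ₑ ^ 2 := by
        rw [lintegral_const_mul _ hF, ← enorm_sq_Lp, hX]
        congr 2
        rw [← ofReal_norm, ← ofReal_norm, LinearIsometry.norm_map]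

theorem norm_iterGradient_le (p : ℕ) {n : ℕ} {X : SCalg}
    {f : Lp ℂ 2 (volume : Measure (Fin n → ℝ≥0))} (hX : toVector X = wignerIntegral n f) :
    ‖iterGradient p X‖ ≤ √((n : ℝ) ^ p) * ‖f‖ := by
  have h := enorm_iterGradient_le p hX
  rw [← ofReal_norm, ← ofReal_norm, ← ENNReal.ofReal_pow (norm_nonneg _),
    ← ENNReal.ofReal_pow (norm_nonneg _), ← ENNReal.ofReal_natCast,
    ← ENNReal.ofReal_pow (Nat.cast_nonneg n), ← ENNReal.ofReal_mul (by positivity),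
    ENNReal.ofReal_le_ofReal_iff (by positivity)] at h
  refine abs_le_of_sq_le_sq' ?_ (by positivity) |>.2
  rwa [mul_pow, Real.sq_sqrt (by positivity)]

/-- The vectors `X Ω` are dense in each chaos. -/
theorem mem_closure_chaos (n : ℕ) (f : Lp ℂ 2 (volume : Measure (Fin n → ℝ≥0))) :
    f ∈ closure {g | ∃ X, toVector X = wignerIntegral n g} := by
  have h1 : ((LinearMap.range toVector).comap (wignerIntegral n).toLinearMap).topologicalClosure =
      ⊤ := by
    rw [Submodule.topologicalClosure_eq_top_iff, Submodule.eq_bot_iff]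
    intro g hg
    rw [Submodule.mem_orthogonal] at hg
    -- The indicator of a box is a tensor product of real functions, so its Wigner integral lies in
    -- `𝒮𝒞_alg Ω` and `g` is orthogonal to it.
    refine eq_zero_of_boxes _ fun A hA hA' => ?_
    have hbox : volume (univ.pi A) ≠ ∞ := by
      rw [volume_pi, Measure.pi_pi]
      exact (ENNReal.prod_lt_top fun i _ => (hA' i).lt_top).ne
    rw [← L2.inner_indicatorConstLp_one (𝕜 := ℂ) (MeasurableSet.univ_pi hA) hbox]
    have heq : indicatorConstLp 2 (MeasurableSet.univ_pi hA) hbox (1 : ℂ) =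
        (memLp_prod n fun i => complexify (indicatorConstLp 2 (hA i) (hA' i) 1)).toLp := by
      refine Lp.ext ?_
      have h2 : ∀ᵐ s ∂(volume : Measure (Fin n → ℝ≥0)), ∀ i,
          complexify (indicatorConstLp 2 (hA i) (hA' i) 1) (s i) = (A i).indicator 1 (s i) :=
        ae_all_iff.2 fun i => (Measure.quasiMeasurePreserving_eval
          (fun _ : Fin n => (volume : Measure ℝ≥0)) i).ae (complexify_indicator (hA i) (hA' i))
      filter_upwards [indicatorConstLp_coeFn (p := 2) (hs := MeasurableSet.univ_pi hA)
        (hμs := hbox) (c := (1 : ℂ)), (memLp_prod n fun i =>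
          complexify (indicatorConstLp 2 (hA i) (hA' i) 1)).coeFn_toLp, h2] with s h3 h4 h5
      rw [h3, h4, Finset.prod_congr rfl fun i _ => h5 i]
      by_cases hs : s ∈ univ.pi A
      · rw [indicator_of_mem hs, Finset.prod_eq_one]
        exact fun i _ => indicator_of_mem (hs i trivial) _
      · rw [indicator_of_notMem hs]
        have : ∃ i, s i ∉ A i := by
          by_contra! h
          exact hs fun i _ => h i
        obtain ⟨i, hi⟩ := this
        exact (Finset.prod_eq_zero (Finset.mem_univ i) (indicator_of_notMem hi _)).symm
    rw [heq]
    exact hg _ (wignerIntegral_prod_mem n fun i => indicatorConstLp 2 (hA i) (hA' i) 1)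
  have h2 : f ∈ ((LinearMap.range toVector).comap
      (wignerIntegral n).toLinearMap).topologicalClosure := by rw [h1]; trivial
  exact h2

/-- Approximate `f` inside the same chaos by kernels coming from `𝒮𝒞_alg`. The bound there makes the
derivatives a Cauchy sequence, and the limit pair lies in the closed graph. -/
theorem wignerIntegral_mem_domain (p n : ℕ) (f : Lp ℂ 2 (volume : Measure (Fin n → ℝ≥0))) :
    wignerIntegral n f ∈ (malliavin p).domain := by
  obtain ⟨g, hg, hgf⟩ := mem_closure_iff_seq_limit.1 (mem_closure_chaos n f)
  choose X hX using hg
  have hcauchy : CauchySeq fun k => iterGradient p (X k) := by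
    have h1 : ∀ k l, dist (iterGradient p (X k)) (iterGradient p (X l)) ≤
        √((n : ℝ) ^ p) * dist (g k) (g l) := by
      intro k l
      rw [dist_eq_norm, dist_eq_norm, ← map_sub]
      exact norm_iterGradient_le p (by rw [map_sub, map_sub, hX, hX])
    have h2 := cauchySeq_iff_tendsto_dist_atTop_0.1 hgf.cauchySeq
    refine cauchySeq_iff_tendsto_dist_atTop_0.2 (squeeze_zero (fun _ => dist_nonneg)
      (fun q => h1 q.1 q.2) ?_)
    simpa using h2.const_mul (√((n : ℝ) ^ p))
  obtain ⟨U, hU⟩ := cauchySeq_tendsto_of_complete hcauchy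
  refine (exists_mem_domain_malliavin (U := U) ?_).1
  refine (gradientGraph p).isClosed_topologicalClosure.mem_of_tendsto
    (((wignerIntegral n).continuous.tendsto f).comp hgf |>.prodMk_nhds hU) (.of_forall fun k => ?_)
  refine Submodule.le_topologicalClosure _ ?_
  have := mem_gradientGraph p (X k)
  rwa [hX] at this

end Domain

/-! ### The formula for Wigner integrals. -/

section Formula

variable {p n : ℕ}

/-- If the concatenation has length `n`, exactly one choice of slots matches the block lengths and
only its term is not forced to vanish; otherwise both sides are zero. -/
theorem extend_interleave (f : (Fin n → ℝ≥0) → ℂ) (t : Fin p → ℝ≥0) (c : Fin (p + 1) → Conf) :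
    Function.extend (toConf n) f 0 (interleave p t c) =
      ∑ i : Fin p ↪o Fin n, Function.extend (toConfs (blockLength i))
        (fun s => f (insertAt i t s)) 0 c := by
  by_cases h : (interleave p t c).1 = n
  · obtain ⟨i, hi⟩ := exists_blockLength t c h
    have hc : ∃ s, toConfs (blockLength i) s = c := by
      have h1 : ∀ j, ∃ s, toConf (blockLength i j) s = c j := fun j => by
        rw [← hi j]
        exact ⟨(c j).2, rfl⟩
      choose s hs using h1
      exact ⟨s, funext hs⟩
    obtain ⟨s, rfl⟩ := hc
    rw [Finset.sum_eq_single i]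
    · rw [interleave_toConfs, (toConf_injective n).extend_apply,
        (measurableEmbedding_toConfs _).injective.extend_apply]
    · intro i' _ hi'
      refine Function.extend_apply' _ _ _ ?_
      rintro ⟨s', hs'⟩
      exact hi' (blockLength_injective (funext fun j => congrArg Sigma.fst (congrFun hs' j)))
    · exact fun h => absurd (Finset.mem_univ i) h
  · rw [Function.extend_apply', Finset.sum_eq_zero]
    · rfl
    · intro i _
      refine Function.extend_apply' _ _ _ ?_
      rintro ⟨s, rfl⟩
      rw [interleave_toConfs] at h
      exact h rfl
    · rintro ⟨s, hs⟩
      exact h (congrArg Sigma.fst hs).symm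

theorem malliavin_wignerIntegral (f : Lp ℂ 2 (volume : Measure (Fin n → ℝ≥0)))
    (hF : wignerIntegral n f ∈ (malliavin p).domain) :
    ∀ᵐ t ∂(volume : Measure (Fin p → ℝ≥0)),
      ∃ hf : ∀ i : Fin p ↪o Fin n,
        MemLp (fun s : (∀ j, Fin (blockLength i j) → ℝ≥0) => f (insertAt i t s)) 2 volume,
        (malliavin p ⟨wignerIntegral n f, hF⟩ : RandomField p) t =
          ∑ i : Fin p ↪o Fin n, tensorIntegral (blockLength i) (hf i).toLp := by
  filter_upwards [agreesWith_malliavin hF, ae_interleave p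
    (coeFn_extendZero (toConf n) (measurableEmbedding_mk n) (map_mk n) f)] with t h1 h2
  set V : Legs (p + 1) := (malliavin p ⟨wignerIntegral n f, hF⟩ : RandomField p) t
  have h3 : ∀ᵐ c ∂(Measure.pi fun _ : Fin (p + 1) => confMeasure),
      V c = ∑ i : Fin p ↪o Fin n, Function.extend (toConfs (blockLength i))
        (fun s => f (insertAt i t s)) 0 c := by
    filter_upwards [h1, h2] with c h4 h5
    rw [← extend_interleave, h4]
    exact h5
  -- Square integrability of the slices is inherited from `V`: on the component of block lengths
  -- given by `i`, the function `V` is the slice of `f`.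
  have hf : ∀ i : Fin p ↪o Fin n,
      MemLp (fun s : (∀ j, Fin (blockLength i j) → ℝ≥0) => f (insertAt i t s)) 2 volume := by
    intro i
    have hι := measurableEmbedding_toConfs (blockLength i)
    have h4 : MemLp (V ∘ toConfs (blockLength i)) 2 volume := by
      rw [← hι.memLp_map_measure_iff, toConfs_map]
      exact (Lp.memLp V).restrict _
    refine h4.ae_eq ?_
    have h5 : ∀ᵐ c ∂(volume.map (toConfs (blockLength i))),
        V c = Function.extend (toConf n) f 0 (interleave p t c) := by
      rw [toConfs_map]
      refine ae_restrict_of_ae ?_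
      filter_upwards [h3] with c hc
      rw [hc, extend_interleave]
    filter_upwards [hι.ae_map_iff.1 h5] with s hs
    rw [Function.comp_apply, hs, interleave_toConfs, (toConf_injective n).extend_apply]
  refine ⟨hf, Lp.ext ?_⟩
  have h4 : ∀ᵐ c ∂(Measure.pi fun _ : Fin (p + 1) => confMeasure), ∀ i : Fin p ↪o Fin n,
      tensorIntegral (blockLength i) (hf i).toLp c = Function.extend (toConfs (blockLength i))
        (fun s => f (insertAt i t s)) 0 c := ae_all_iff.2 fun i =>
    (coeFn_extendZero (toConfs (blockLength i)) (measurableEmbedding_toConfs (blockLength i))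
      (toConfs_map (blockLength i)) (hf i).toLp).trans
      (extend_ae_congr (measurableEmbedding_toConfs (blockLength i)) (toConfs_map (blockLength i))
        (hf i).coeFn_toLp)
  filter_upwards [h3, h4, Lp.coeFn_finsetSum Finset.univ fun i : Fin p ↪o Fin n =>
    tensorIntegral (blockLength i) (hf i).toLp] with c h5 h6 h7
  rw [h5, h7, Finset.sum_apply]
  exact Finset.sum_congr rfl fun i _ => (h6 i).symm

end Formula

end WignerSpace

end

theorem mainTheorem7 :
    (∀ (p n : ℕ) (hp : 1 ≤ p) (hpn : p ≤ n) (f : Lp ℂ 2 (volume : Measure (Fin n → ℝ≥0))),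
      ∃ hF : wignerIntegral n f ∈ (malliavin p).domain,
        ∀ᵐ t ∂(volume : Measure (Fin p → ℝ≥0)),
          ∃ hf : ∀ i : Fin p ↪o Fin n,
            MemLp (fun s : (∀ j, Fin (blockLength i j) → ℝ≥0) => f (insertAt i t s)) 2 volume,
            (malliavin p ⟨wignerIntegral n f, hF⟩ : RandomField p) t =
              ∑ i : Fin p ↪o Fin n, tensorIntegral (blockLength i) (hf i).toLp) ∧
    (∀ (p n : ℕ) (hpn : n < p) (F : Fock) (hF : F ∈ finiteChaos n),
      ∃ hF' : F ∈ (malliavin p).domain, malliavin p ⟨F, hF'⟩ = 0) := by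
  refine ⟨fun p n _ _ f => ?_, fun p n hpn F hF => ?_⟩
  · exact ⟨wignerIntegral_mem_domain p n f, malliavin_wignerIntegral f _⟩
  · exact exists_mem_domain_malliavin (finiteChaos_subset hpn hF)
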